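/- Let $m,n\ge 1$ be integers. Let $\mathcal P_0^m(\mathbb R^n)$ be the set of real polynomials in $n$ variables of degree at most $m$ that vanish at the origin; it is a commutative non-unital ring under the jet product (multiply and discard all terms of degree greater than $m$). Let $I\lhd\mathcal P_0^m(\mathbb R^n)$ be an ideal and $p\in\mathcal P_0^m(\mathbb R^n)$. If $I$ strongly implies $p$ in the direction $\omega$ for every $\omega\in Allow(I)$, then $I$ implies $p$. The notions are the following. $|\cdot|$ is the Euclidean norm, $S^{n-1}$ the unit sphere, and $\mathrm{dist}(x,\emptyset)=+\infty$. For $\Omega\subset S^{n-1}$, $\omega\in S^{n-1}$ and $\delta,r,\rho>0$, $K\ge1$ put $$D(\Omega,\delta)=\{\omega'\in S^{n-1}:\mathrm{dist}(\omega',\Omega)<\delta\},\qquad \Gamma(\Omega,\delta,r)=\{x\in\mathbb R^n:0<|x|<r,\ \mathrm{dist}(x/|x|,\Omega)<\delta\},$$ $D(\omega,\delta)=D(\{\omega\},\delta)$, $\Gamma(\omega,\delta,r)=\Gamma(\{\omega\},\delta,r)$, and $\mathrm{Ann}_K(\rho)=\{x:\rho/K<|x|<K\rho\}$. * **Allowed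 directions.** $\omega\in S^{n-1}$ is *forbidden* for $I$ if there are $p_1,\dots,p_L\in I$ and $c,\delta,r>0$ such that $|p_1(x)|+\dots+|p_L(x)|>c|x|^m$ for all $x\in\Gamma(\omega,\delta,r)$. $Allow(I)\subset S^{n-1}$ is the set of directions that are not forbidden. * **Negligible functions.** Let $U\subset\mathbb R^n$ be open. A function $F\in C^m(U)$ is *negligible* for $\Omega\subset S^{n-1}$ if for all $\epsilon>0$ there are $\delta,r>0$ such that $\Gamma(\Omega,\delta,r)\subset U$; $|\partial^\alpha F(x)|\le\epsilon|x|^{m-|\alpha|}$ for all $x\in\Gamma(\Omega,\delta,r)$ and $|\alpha|\le m$; and $$\Big|\partial^\alpha F(x)-\sum_{|\gamma|\le m-|\alpha|}\tfrac1{\gamma!}\,\partial^{\alpha+\gamma}F(y)\,(x-y)^\gamma\Big|\le\epsilon|x-y|^{m-|\alpha|}$$ for all distinct $x,y\in\Gamma(\Omega,\delta,r)$ and all $|\alpha|\le m$. * **Strong directional implication.** $I$ *strongly implies $p$ in the direction $\omega$* if there are $\delta,r>0$, $Q_1,\dots,Q_L\in I$, functions $S_1,\dots,S_L,F\in C^m(\Gamma(\omega,\delta,r))$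 and constants $C_1,\dots,C_L>0$ such that $F$ (as a function on $U=\Gamma(\omega,\delta,r)$) is negligible for $Allow(I)\cap D(\omega,\delta)$; $|\partial^\alpha S_l(x)|\le C_l|x|^{-|\alpha|}$ for all $|\alpha|\le m$, $1\le l\le L$, $x\in\Gamma(\omega,\delta,r)$; and $p(x)=\sum_{l=1}^L S_l(x)Q_l(x)+F(x)$ for all $x\in\Gamma(\omega,\delta,r)$. * **Implication.** $I$ *implies* $p$ if there are $A>0$ and $Q_1,\dots,Q_L\in I$ such that for any $\epsilon>0$ there are $\delta,r>0$ such that for any $0<\rho\le r$ there are $F,S_1,\dots,S_L\in C^m(\mathrm{Ann}_4(\rho))$ with $|\partial^\alpha F(x)|\le\epsilon\rho^{m-|\alpha|}$ and $|\partial^\alpha S_l(x)|\le A\rho^{-|\alpha|}$ for all $x\in\mathrm{Ann}_4(\rho)$, $|\alpha|\le m$, $1\le l\le L$, and $$p(x)=F(x)+\sum_{l=1}^L S_l(x)Q_l(x)\quad\text{for all }x\in\mathrm{Ann}_2(\rho)\text{ with }\mathrm{dist}(x/|x|,Allow(I))<\delta .$$ -/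

import Mathlib

/-!
Jets at the origin of `ℝⁿ`, allowed directions, negligible functions, and (strong directional)
implication of jets by ideals of jets.

A real valued function on an open set `U ⊆ ℝⁿ` is represented by a total function together with
regularity on `U` (`ContDiffOn ℝ m f U` is `f ∈ C^m(U)`); only its values and derivatives at points
of the open set `U` are ever used.
-/

namespace ImpliedJets

/-- `ℝⁿ` with the Euclidean metric. -/
abbrev Space (n : ℕ) : Type := EuclideanSpace ℝ (Fin n)

/-! ### Multi-indices and partial derivatives -/

/-- A multi-index `α ∈ ℕⁿ`. -/
abbrev MultiIndex (n : ℕ) : Type := Fin n → ℕ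

/-- The order `|α| = α₁ + ⋯ + αₙ`. -/
def order {n : ℕ} (α : MultiIndex n) : ℕ := ∑ i, α i

/-- `α! = α₁! ⋯ αₙ!`. -/
def multiFactorial {n : ℕ} (α : MultiIndex n) : ℕ := ∏ i, Nat.factorial (α i)

/-- `x^α = x₁^α₁ ⋯ xₙ^αₙ`. -/
def multiPow {n : ℕ} (x : Space n) (α : MultiIndex n) : ℝ := ∏ i, x i ^ α i

/-- The finite set of all multi-indices of order at most `N`. -/
def multiIndicesLE (n N : ℕ) : Finset (MultiIndex n) :=
  (Fintype.piFinset fun _ : Fin n => Finset.range (N + 1)).filter fun γ => order γ ≤ N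

theorem mem_multiIndicesLE {n N : ℕ} {γ : MultiIndex n} :
    γ ∈ multiIndicesLE n N ↔ order γ ≤ N := by
  unfold multiIndicesLE
  rw [Finset.mem_filter, Fintype.mem_piFinset, and_iff_right_iff_imp]
  intro h i
  rw [Finset.mem_range]
  have h1 : γ i ≤ order γ := Finset.single_le_sum (fun j _ => Nat.zero_le (γ j)) (Finset.mem_univ i)
  omega

/-- The first order partial derivative `∂f/∂xᵢ`. -/
noncomputable def pderiv {n : ℕ} (i : Fin n) (f : Space n → ℝ) : Space n → ℝ :=
  fun x => fderiv ℝ f x (EuclideanSpace.single i 1)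

/-- `∂^α f = ∂₁^α₁ (∂₂^α₂ (⋯ ∂ₙ^αₙ f))`. -/
noncomputable def multiDeriv {n : ℕ} (α : MultiIndex n) (f : Space n → ℝ) : Space n → ℝ :=
  (List.finRange n).foldr (fun i g => (pderiv i)^[α i] g) f

/-! ### Jets and ideals of jets -/

/-- The value of the polynomial `p` at the point `x`. -/
noncomputable def evalAt {n : ℕ} (p : MvPolynomial (Fin n) ℝ) (x : Space n) : ℝ :=
  MvPolynomial.eval (fun i => x i) p

/-- The `m`-jet at the origin of a polynomial: its Taylor polynomial of degree `m` there, that is,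
the sum of its homogeneous parts of degree at most `m`. -/
noncomputable def jet {n : ℕ} (m : ℕ) (p : MvPolynomial (Fin n) ℝ) : MvPolynomial (Fin n) ℝ :=
  ∑ k ∈ Finset.range (m + 1), MvPolynomial.homogeneousComponent k p

/-- The product of `m`-jets: the product of polynomials followed by truncation to degree `m`. -/
noncomputable def jetMul {n : ℕ} (m : ℕ) (p q : MvPolynomial (Fin n) ℝ) :
    MvPolynomial (Fin n) ℝ :=
  jet m (p * q)

/-- The space `𝒫₀^m(ℝⁿ)` of polynomials of degree at most `m` that vanish at the origin. -/
def JetSpaceZero (n m : ℕ) : Set (MvPolynomial (Fin n) ℝ) :=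
  {p | p.totalDegree ≤ m ∧ evalAt p 0 = 0}

/-- `I` is an ideal of the commutative non-unital ring `𝒫₀^m(ℝⁿ)` (with the jet product): an
additive subgroup of `𝒫₀^m(ℝⁿ)` that is stable under multiplication by elements of `𝒫₀^m(ℝⁿ)`.
Ideals that are moreover real vector subspaces are the ideals of `𝒫^m(ℝⁿ)` that are contained in
`𝒫₀^m(ℝⁿ)`; they are included. -/
structure IsJetIdeal {n : ℕ} (m : ℕ) (I : AddSubgroup (MvPolynomial (Fin n) ℝ)) : Prop where
  subset_jetSpaceZero : ∀ q ∈ I, q ∈ JetSpaceZero n m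
  mul_mem : ∀ p ∈ JetSpaceZero n m, ∀ q ∈ I, jetMul m p q ∈ I

/-! ### Directions, cones, annuli -/

/-- The set of directions `S^{n-1}`. -/
def Directions (n : ℕ) : Set (Space n) := Metric.sphere 0 1

/-- The dome `D(Ω, δ)` of directions at distance less than `δ` from `Ω` (empty if `Ω` is). -/
def dome {n : ℕ} (Ω : Set (Space n)) (δ : ℝ) : Set (Space n) :=
  Directions n ∩ Metric.thickening δ Ω

/-- The cone `Γ(Ω, δ, r) = {x : 0 < |x| < r, dist(x/|x|, Ω) < δ}` (empty if `Ω` is). -/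
def cone {n : ℕ} (Ω : Set (Space n)) (δ r : ℝ) : Set (Space n) :=
  {x | 0 < ‖x‖ ∧ ‖x‖ < r ∧ ‖x‖⁻¹ • x ∈ Metric.thickening δ Ω}

/-- The annulus `Ann_K(ρ) = {x : ρ/K < |x| < Kρ}`. -/
def annulus (n : ℕ) (K ρ : ℝ) : Set (Space n) :=
  {x | ρ / K < ‖x‖ ∧ ‖x‖ < K * ρ}

/-! ### Allowed directions -/

/-- The direction `ω` is forbidden for the jets `p₁, …, p_L`:
`|p₁(x)| + ⋯ + |p_L(x)| > c |x|^m` on some cone in the direction `ω`, for some `c > 0`. -/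
def IsForbiddenFor {n : ℕ} (m : ℕ) {L : ℕ} (p : Fin L → MvPolynomial (Fin n) ℝ) (ω : Space n) :
    Prop :=
  ∃ c > (0 : ℝ), ∃ δ > (0 : ℝ), ∃ r > (0 : ℝ),
    ∀ x ∈ cone {ω} δ r, ∑ l, |evalAt (p l) x| > c * ‖x‖ ^ m

/-- `Allow(I)`: the directions that are not forbidden for any finite family of elements of `I`. -/
def Allow {n : ℕ} (m : ℕ) (I : AddSubgroup (MvPolynomial (Fin n) ℝ)) : Set (Space n) :=
  {ω | ω ∈ Directions n ∧
    ¬ ∃ (L : ℕ) (p : Fin L → MvPolynomial (Fin n) ℝ), (∀ l, p l ∈ I) ∧ IsForbiddenFor m p ω}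

/-! ### Implied jets -/

/-- The ideal `I` implies the jet `p`. -/
def Implies {n : ℕ} (m : ℕ) (I : AddSubgroup (MvPolynomial (Fin n) ℝ))
    (p : MvPolynomial (Fin n) ℝ) : Prop :=
  ∃ A > (0 : ℝ), ∃ (L : ℕ) (Q : Fin L → MvPolynomial (Fin n) ℝ), (∀ l, Q l ∈ I) ∧
    ∀ ε > (0 : ℝ), ∃ δ > (0 : ℝ), ∃ r > (0 : ℝ), ∀ ρ : ℝ, 0 < ρ → ρ ≤ r →
      ∃ (F : Space n → ℝ) (S : Fin L → Space n → ℝ),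
        ContDiffOn ℝ m F (annulus n 4 ρ) ∧
        (∀ l, ContDiffOn ℝ m (S l) (annulus n 4 ρ)) ∧
        (∀ x ∈ annulus n 4 ρ, ∀ α : MultiIndex n, order α ≤ m →
          |multiDeriv α F x| ≤ ε * ρ ^ (m - order α)) ∧
        (∀ x ∈ annulus n 4 ρ, ∀ α : MultiIndex n, order α ≤ m → ∀ l,
          |multiDeriv α (S l) x| ≤ A * ρ ^ (-(order α : ℤ))) ∧
        (∀ x ∈ annulus n 2 ρ, ‖x‖⁻¹ • x ∈ Metric.thickening δ (Allow m I) →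
          evalAt p x = F x + ∑ l, S l x * evalAt (Q l) x)

/-! ### Negligible functions and strong directional implication -/

/-- A function `F ∈ C^m(U)` on an open set `U` is (`m`-)negligible for the set of directions `Ω`. -/
def IsNegligible {n : ℕ} (m : ℕ) (U Ω : Set (Space n)) (F : Space n → ℝ) : Prop :=
  ∀ ε > (0 : ℝ), ∃ δ > (0 : ℝ), ∃ r > (0 : ℝ),
    cone Ω δ r ⊆ U ∧
    (∀ x ∈ cone Ω δ r, ∀ α : MultiIndex n, order α ≤ m →
      |multiDeriv α F x| ≤ ε * ‖x‖ ^ (m - order α)) ∧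
    (∀ x ∈ cone Ω δ r, ∀ y ∈ cone Ω δ r, x ≠ y → ∀ α : MultiIndex n, order α ≤ m →
      |multiDeriv α F x - ∑ γ ∈ multiIndicesLE n (m - order α),
          1 / (multiFactorial γ : ℝ) * multiDeriv (α + γ) F y * multiPow (x - y) γ| ≤
        ε * ‖x - y‖ ^ (m - order α))

/-- The ideal `I` strongly implies the jet `p` in the direction `ω`. -/
def StronglyImpliesInDirection {n : ℕ} (m : ℕ) (I : AddSubgroup (MvPolynomial (Fin n) ℝ))
    (p : MvPolynomial (Fin n) ℝ) (ω : Space n) : Prop :=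
  ∃ δ > (0 : ℝ), ∃ r > (0 : ℝ), ∃ (L : ℕ) (Q : Fin L → MvPolynomial (Fin n) ℝ)
      (S : Fin L → Space n → ℝ) (C : Fin L → ℝ) (F : Space n → ℝ),
    (∀ l, Q l ∈ I) ∧
    (∀ l, ContDiffOn ℝ m (S l) (cone {ω} δ r)) ∧
    (∀ l, 0 < C l) ∧
    ContDiffOn ℝ m F (cone {ω} δ r) ∧
    IsNegligible m (cone {ω} δ r) (Allow m I ∩ dome {ω} δ) F ∧
    (∀ α : MultiIndex n, order α ≤ m → ∀ l, ∀ x ∈ cone {ω} δ r,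
      |multiDeriv α (S l) x| ≤ C l * ‖x‖ ^ (-(order α : ℤ))) ∧
    (∀ x ∈ cone {ω} δ r, evalAt p x = ∑ l, S l x * evalAt (Q l) x + F x)

end ImpliedJets

/-! The set of allowed directions is closed in the sphere (`isClosed_allow`), hence compact, so
finitely many of the given directional decompositions suffice and can be patched together. The
patching is done at unit scale, in the variable `u = x / ρ`: a partition of unity at a fixed scale
`σ`, below a Lebesgue number of the cover by cones, is chosen once and then dilated by every small
`ρ`. Multiplying `p = ∑ S_l Q_l + F` by a dilated bump multiplies the bounds on `S_l` by a constant
independent of `ρ` and `ε`, because `|x|` is comparable to `ρ` on the support. `ImpliesWeighted`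
records the outcome for one bump and is additive in the bump.

The difficulty is the error `F`. It is small only in a thin cone about the allowed directions, of
aperture `δ` depending on `ε`, whereas implication asks for a small function on a whole annulus. A
plain cutoff to the thin cone would multiply derivatives by powers of `δ⁻¹` and destroy the
smallness. The Taylor remainder estimates in the definition of negligibility avoid this: they say
that the jets of `F` form a Whitney field of norm at most `ε`, and such a field extends with norm at
most `C ε`, where `C` depends only on `n` and `m` (`exists_extension`).

The extension is carried out on finitely many dyadic scales, from the width `s` of the thin
neighbourhood up to `ρ`. On each intermediate scale Taylor polynomials are averaged by a partition
of unity (`exists_approximation`); consecutive averages differ by an amount proper to their scale,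
so a cutoff of that scale joins them at bounded cost (`exists_glue`). The transition shells are
disjoint, so the number of scales does not enter the constant. `IsNegligible.exists_global` applies
this to `F`, and `impliesWeighted_of_bump` combines it with one bump. -/

namespace ImpliedJets

open Filter Topology

variable {n m : ℕ}

/-! ### Partial derivatives and iterated Fréchet derivatives -/

/-- The coordinate vectors of `ℝⁿ`. -/
noncomputable def coordVec (i : Fin n) : Space n := EuclideanSpace.single i 1

theorem norm_coordVec (i : Fin n) : ‖coordVec i‖ = 1 := by simp [coordVec]

/-- Iterated partial derivatives along a list of coordinate directions. -/
noncomputable def listDeriv (l : List (Fin n)) (f : Space n → ℝ) : Space n → ℝ :=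
  l.foldr pderiv f

/-- The list of coordinates in which `∂^α` differentiates. -/
def indexList (α : MultiIndex n) : List (Fin n) :=
  (List.finRange n).flatMap fun i => List.replicate (α i) i

theorem multiDeriv_eq_listDeriv (α : MultiIndex n) (f : Space n → ℝ) :
    multiDeriv α f = listDeriv (indexList α) f := by
  unfold multiDeriv listDeriv indexList
  induction List.finRange n with
  | nil => rfl
  | cons i t ih =>
    rw [List.foldr_cons, ih, List.flatMap_cons, List.foldr_append]
    generalize List.foldr pderiv f _ = g
    induction α i with
    | zero => rfl
    | succ k ihk => rw [Function.iterate_succ_apply', ihk, List.replicate_succ, List.foldr_cons]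

theorem length_indexList (α : MultiIndex n) : (indexList α).length = order α := by
  simp [indexList, order, List.length_flatMap, Fin.sum_univ_def]

theorem count_indexList (α : MultiIndex n) (i : Fin n) : (indexList α).count i = α i := by
  have h : ∀ l : List (Fin n), l.Nodup →
      (l.flatMap fun i => List.replicate (α i) i).count i = if i ∈ l then α i else 0 := by
    intro l
    induction l with
    | nil => simp
    | cons j t ih =>
      intro hl
      rw [List.nodup_cons] at hl
      rw [List.flatMap_cons, List.count_append, ih hl.2, List.count_replicate]
      by_cases hij : j = i
      · subst hij; simp [hl.1]
      · simp [hij, Ne.symm hij]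
  rw [indexList, h _ (List.nodup_finRange n), if_pos (List.mem_finRange i)]

theorem listDeriv_eq_iteratedFDeriv {f : Space n → ℝ} (l : List (Fin n)) {x : Space n}
    (hf : ContDiffAt ℝ m f x) (hl : l.length ≤ m) :
    listDeriv l f x = iteratedFDeriv ℝ l.length f x fun j => coordVec (l.get j) := by
  induction l generalizing x with
  | nil => simp [listDeriv]
  | cons i t ih =>
    simp only [List.length_cons] at hl
    have hev : listDeriv t f =ᶠ[𝓝 x] fun y => iteratedFDeriv ℝ t.length f y
        fun j => coordVec (t.get j) :=
      (hf.eventually (by simp)).mono fun y hy => ih hy (by omega)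
    have hd : DifferentiableAt ℝ (iteratedFDeriv ℝ t.length f) x :=
      hf.differentiableAt_iteratedFDeriv (by exact_mod_cast hl)
    change fderiv ℝ (listDeriv t f) x (coordVec i) = _
    rw [hev.fderiv_eq, fderiv_continuousMultilinear_apply_const_apply hd]
    erw [iteratedFDeriv_succ_apply_left]
    rfl

theorem abs_multiDeriv_le {f : Space n → ℝ} {x : Space n} (hf : ContDiffAt ℝ m f x)
    {α : MultiIndex n} (hα : order α ≤ m) :
    |multiDeriv α f x| ≤ ‖iteratedFDeriv ℝ (order α) f x‖ := by
  rw [← length_indexList] at hα ⊢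
  rw [multiDeriv_eq_listDeriv, listDeriv_eq_iteratedFDeriv _ hf hα, ← Real.norm_eq_abs]
  refine (ContinuousMultilinearMap.le_opNorm _ _).trans ?_
  simp [norm_coordVec]

theorem contDiffAt_pderiv {g : Space n → ℝ} {x : Space n} {k : ℕ} (hg : ContDiffAt ℝ (k + 1 : ℕ) g x)
    (i : Fin n) : ContDiffAt ℝ k (pderiv i g) x :=
  (hg.fderiv_right (m := k) (by norm_cast)).clm_apply contDiffAt_const

theorem contDiffAt_listDeriv {f : Space n → ℝ} {x : Space n} (l : List (Fin n)) {k : ℕ}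
    (hf : ContDiffAt ℝ (k + l.length : ℕ) f x) : ContDiffAt ℝ k (listDeriv l f) x := by
  induction l generalizing k with
  | nil => exact hf
  | cons i t ih =>
    refine contDiffAt_pderiv (ih ?_) i
    rw [List.length_cons] at hf
    rwa [add_right_comm, add_assoc]

theorem pderiv_comm {g : Space n → ℝ} {x : Space n} (hg : ContDiffAt ℝ 2 g x) (i j : Fin n) :
    pderiv i (pderiv j g) x = pderiv j (pderiv i g) x := by
  have hd : DifferentiableAt ℝ (fderiv ℝ g) x :=
    (hg.fderiv_right (m := 1) (by norm_num)).differentiableAt (by norm_num)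
  have key : ∀ i j : Fin n, pderiv i (pderiv j g) x =
      fderiv ℝ (fderiv ℝ g) x (coordVec i) (coordVec j) := by
    intro i j
    change fderiv ℝ (fun y => fderiv ℝ g y (coordVec j)) x (coordVec i) = _
    rw [fderiv_clm_apply hd (differentiableAt_const _)]
    simp
  rw [key, key]
  exact (hg.isSymmSndFDerivAt (by simp)) _ _

theorem listDeriv_perm {f : Space n → ℝ} {l l' : List (Fin n)} (h : l.Perm l') {x : Space n}
    (hf : ContDiffAt ℝ m f x) (hl : l.length ≤ m) : listDeriv l f x = listDeriv l' f x := by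
  induction h generalizing x with
  | nil => rfl
  | cons i _ ih =>
    rename_i t t' _
    have hev : listDeriv t f =ᶠ[𝓝 x] listDeriv t' f :=
      (hf.eventually (by simp)).mono fun y hy => ih hy (by simp at hl; omega)
    exact congrArg (fun L : Space n →L[ℝ] ℝ => L (coordVec i)) hev.fderiv_eq
  | swap i j t =>
    refine pderiv_comm (contDiffAt_listDeriv t (k := 2) (hf.of_le ?_)) _ _
    simp only [List.length_cons] at hl
    exact_mod_cast (by omega : 2 + t.length ≤ m)
  | trans h1 _ ih1 ih2 => exact (ih1 hf hl).trans (ih2 hf (h1.length_eq ▸ hl))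

/-- Mixed partial derivatives commute, so only the number of occurrences of each coordinate in `v`
matters; `α` counts them. -/
theorem exists_multiDeriv_eq {f : Space n → ℝ} {x : Space n} (hf : ContDiffAt ℝ m f x) {k : ℕ}
    (hk : k ≤ m) (v : Fin k → Fin n) : ∃ α : MultiIndex n, order α = k ∧
      iteratedFDeriv ℝ k f x (fun j => coordVec (v j)) = multiDeriv α f x := by
  have hlen : (List.ofFn v).length = k := by simp
  let α : MultiIndex n := fun i => (List.ofFn v).count i
  have hperm : (indexList α).Perm (List.ofFn v) :=
    List.perm_iff_count.2 fun i => count_indexList α i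
  have hα : order α = k := by rw [← length_indexList, hperm.length_eq, hlen]
  refine ⟨α, hα, ?_⟩
  rw [multiDeriv_eq_listDeriv, listDeriv_perm hperm hf (by rw [length_indexList]; omega),
    listDeriv_eq_iteratedFDeriv _ hf (by omega)]
  clear hperm hα α
  have aux : ∀ (q : ℕ) (hq : q = k), iteratedFDeriv ℝ k f x (fun j => coordVec (v j)) =
      iteratedFDeriv ℝ q f x fun j => coordVec (v (Fin.cast hq j)) := by
    rintro q rfl; rfl
  rw [aux _ hlen]
  simp only [List.get_ofFn]

/-- Expanding every argument in coordinates yields `n ^ k` terms, each a partial derivative times a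
product of coordinates. -/
theorem norm_iteratedFDeriv_le {f : Space n → ℝ} {x : Space n} (hf : ContDiffAt ℝ m f x) {k : ℕ}
    (hk : k ≤ m) {B : ℝ} (hB : 0 ≤ B)
    (h : ∀ α : MultiIndex n, order α = k → |multiDeriv α f x| ≤ B) :
    ‖iteratedFDeriv ℝ k f x‖ ≤ (n : ℝ) ^ k * B := by
  refine ContinuousMultilinearMap.opNorm_le_bound (by positivity) fun v => ?_
  have hv : v = fun j => ∑ i, (v j) i • coordVec i := by
    funext j
    ext i
    simp [coordVec, Finset.sum_apply, Pi.single_apply]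
  conv_lhs => rw [hv]
  rw [ContinuousMultilinearMap.map_sum]
  refine (norm_sum_le _ _).trans ?_
  have hterm : ∀ r : Fin k → Fin n,
      ‖iteratedFDeriv ℝ k f x fun j => (v j) (r j) • coordVec (r j)‖ ≤ (∏ j, ‖v j‖) * B := by
    intro r
    obtain ⟨α, hα, hαr⟩ := exists_multiDeriv_eq hf hk r
    rw [ContinuousMultilinearMap.map_smul_univ, hαr, norm_smul, norm_prod]
    gcongr with j
    · exact PiLp.norm_apply_le (v j) (r j)
    · exact h α hα
  refine (Finset.sum_le_sum fun r _ => hterm r).trans ?_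
  rw [Finset.sum_const, nsmul_eq_mul, Finset.card_univ, Fintype.card_fun, Fintype.card_fin,
    Fintype.card_fin]
  push_cast
  apply le_of_eq
  ring

/-! ### Functions with controlled derivatives at a point -/

/-- `f` is `C^m` at `x` with derivatives of order `k ≤ m` bounded by `A s^{-k}`. -/
def JetBound (m : ℕ) (f : Space n → ℝ) (x : Space n) (A s : ℝ) : Prop :=
  ContDiffAt ℝ m f x ∧ ∀ k ≤ m, ‖iteratedFDeriv ℝ k f x‖ ≤ A * s⁻¹ ^ k

namespace JetBound

variable {f g : Space n → ℝ} {x : Space n} {A B s t : ℝ}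

theorem congr (hf : JetBound m f x A s) (h : g =ᶠ[𝓝 x] f) : JetBound m g x A s :=
  ⟨hf.1.congr_of_eventuallyEq h, fun k hk => by
    rw [(h.iteratedFDeriv ℝ k).self_of_nhds]; exact hf.2 k hk⟩

theorem nonneg (hf : JetBound m f x A s) : 0 ≤ A := by
  have := (norm_nonneg _).trans (hf.2 0 (Nat.zero_le m))
  simpa using this

theorem mono (hf : JetBound m f x A s) (hs : 0 < s) (h : A ≤ B) : JetBound m f x B s :=
  ⟨hf.1, fun k hk => (hf.2 k hk).trans (by gcongr)⟩

theorem zero (hA : 0 ≤ A) (hs : 0 < s) : JetBound m (fun _ : Space n => (0 : ℝ)) x A s :=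
  ⟨contDiffAt_const, fun k _ => by
    rw [iteratedFDeriv_fun_zero]
    simp only [Pi.zero_apply, norm_zero]
    positivity⟩

theorem add (hf : JetBound m f x A s) (hg : JetBound m g x B s) :
    JetBound m (fun y => f y + g y) x (A + B) s :=
  ⟨hf.1.add hg.1, fun k hk => by
    have hk' : ((k : ℕ) : WithTop ℕ∞) ≤ m := by exact_mod_cast hk
    rw [fun_iteratedFDeriv_add_apply (hf.1.of_le hk') (hg.1.of_le hk'), add_mul]
    exact (norm_add_le _ _).trans (add_le_add (hf.2 k hk) (hg.2 k hk))⟩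

theorem neg (hf : JetBound m f x A s) : JetBound m (fun y => -f y) x A s :=
  ⟨hf.1.neg, fun k hk => by
    have : (fun y => -f y) = -f := rfl
    rw [this, iteratedFDeriv_neg_apply, norm_neg]
    exact hf.2 k hk⟩

theorem sub (hf : JetBound m f x A s) (hg : JetBound m g x B s) :
    JetBound m (fun y => f y - g y) x (A + B) s := by
  simpa only [sub_eq_add_neg] using hf.add hg.neg

theorem sum {ι : Type*} {T : Finset ι} {f : ι → Space n → ℝ} {A : ι → ℝ} (hs : 0 < s)
    (hf : ∀ i ∈ T, JetBound m (f i) x (A i) s) :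
    JetBound m (fun y => ∑ i ∈ T, f i y) x (∑ i ∈ T, A i) s := by
  classical
  induction T using Finset.induction_on with
  | empty => simpa using zero le_rfl hs
  | insert i T hi ih =>
    simp only [Finset.sum_insert hi]
    exact (hf i (by simp)).add (ih fun j hj => hf j (by simp [hj]))

theorem mul (hf : JetBound m f x A s) (hg : JetBound m g x B s) (hs : 0 < s) :
    JetBound m (fun y => f y * g y) x (2 ^ m * A * B) s := by
  refine ⟨hf.1.mul hg.1, fun k hk => ?_⟩
  have hA := hf.nonneg
  have hB := hg.nonneg
  have hk' : ((k : ℕ) : WithTop ℕ∞) ≤ m := by exact_mod_cast hk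
  -- Regularity at `x` spreads to an open neighbourhood `w`, on which derivatives within `w` are the
  -- ordinary ones and the Leibniz bound applies.
  obtain ⟨u, hu, hfu⟩ := hf.1.contDiffOn le_rfl (by simp)
  obtain ⟨v, hv, hgv⟩ := hg.1.contDiffOn le_rfl (by simp)
  obtain ⟨w, hwsub, hwo, hxw⟩ := mem_nhds_iff.1
    (inter_mem (by simpa using hu) (by simpa using hv) : u ∩ v ∈ 𝓝 x)
  have key := norm_iteratedFDerivWithin_mul_le (hfu.mono (hwsub.trans Set.inter_subset_left))
    (hgv.mono (hwsub.trans Set.inter_subset_right)) hwo.uniqueDiffOn hxw hk'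
  simp only [iteratedFDerivWithin_of_isOpen _ hwo hxw] at key
  refine key.trans ?_
  have : ∀ i ∈ Finset.range (k + 1), (k.choose i : ℝ) * ‖iteratedFDeriv ℝ i f x‖ *
      ‖iteratedFDeriv ℝ (k - i) g x‖ ≤ (k.choose i : ℝ) * (A * B * s⁻¹ ^ k) := by
    intro i hi
    have hi' : i ≤ k := Nat.lt_succ_iff.1 (Finset.mem_range.1 hi)
    have h1 := hf.2 i (hi'.trans hk)
    have h2 := hg.2 (k - i) ((Nat.sub_le k i).trans hk)
    calc _ ≤ (k.choose i : ℝ) * (A * s⁻¹ ^ i) * (B * s⁻¹ ^ (k - i)) := by gcongr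
      _ = (k.choose i : ℝ) * (A * B * (s⁻¹ ^ i * s⁻¹ ^ (k - i))) := by ring
      _ = _ := by rw [← pow_add, Nat.add_sub_cancel' hi']
  refine (Finset.sum_le_sum this).trans ?_
  rw [← Finset.sum_mul]
  have hc : (∑ i ∈ Finset.range (k + 1), (k.choose i : ℝ)) = 2 ^ k := by
    exact_mod_cast Nat.sum_range_choose k
  rw [hc]
  have h2 : (2 : ℝ) ^ k ≤ 2 ^ m := pow_le_pow_right₀ (by norm_num) hk
  calc (2 : ℝ) ^ k * (A * B * s⁻¹ ^ k) ≤ 2 ^ m * (A * B * s⁻¹ ^ k) := by gcongr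
    _ = _ := by ring

/-- Enlarging the scale, for bounds of the form `A s^{m-k}`. -/
theorem enlarge (hf : JetBound m f x (A * s ^ m) s) (hs : 0 < s) (hst : s ≤ t) :
    JetBound m f x (A * t ^ m) t := by
  have ht : 0 < t := hs.trans_le hst
  have hA : 0 ≤ A := nonneg_of_mul_nonneg_left hf.nonneg (by positivity)
  refine ⟨hf.1, fun k hk => (hf.2 k hk).trans ?_⟩
  have e : ∀ r : ℝ, 0 < r → A * r ^ m * r⁻¹ ^ k = A * r ^ (m - k) := by
    intro r hr
    rw [mul_assoc, inv_pow, ← pow_sub₀ r hr.ne' hk]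
  rw [e s hs, e t ht]
  gcongr

/-- Changing the scale at the cost of a constant. -/
theorem rescale (hf : JetBound m f x A s) {c : ℝ} (hs : 0 < s) (ht : 0 < t) (hc : 1 ≤ c)
    (h : t ≤ c * s) : JetBound m f x (c ^ m * A) t := by
  have hA := hf.nonneg
  refine ⟨hf.1, fun k hk => (hf.2 k hk).trans ?_⟩
  have h1 : s⁻¹ ≤ c * t⁻¹ := by
    rw [inv_eq_one_div, div_le_iff₀ hs]
    have : t * t⁻¹ = 1 := mul_inv_cancel₀ ht.ne'
    have ht' : 0 < t⁻¹ := by positivity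
    nlinarith
  calc A * s⁻¹ ^ k ≤ A * (c * t⁻¹) ^ k := by gcongr
    _ = c ^ k * A * t⁻¹ ^ k := by rw [mul_pow]; ring
    _ ≤ c ^ m * A * t⁻¹ ^ k := by
      have : c ^ k ≤ c ^ m := pow_le_pow_right₀ hc hk
      gcongr

/-- Dilations. -/
theorem comp_smul (hf : ContDiff ℝ m f) {ρ : ℝ} (hρ : 0 < ρ) (h : JetBound m f (ρ⁻¹ • x) A s) :
    JetBound m (fun y => f (ρ⁻¹ • y)) x A (s * ρ) := by
  refine ⟨(hf.comp (contDiff_const_smul ρ⁻¹)).contDiffAt, fun k hk => ?_⟩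
  have hk' : ((k : ℕ) : WithTop ℕ∞) ≤ m := by exact_mod_cast hk
  rw [iteratedFDeriv_comp_const_smul _ (hf.of_le hk'), norm_smul, norm_pow, Real.norm_eq_abs,
    abs_of_pos (inv_pos.2 hρ), mul_inv, mul_pow]
  have := h.2 k hk
  calc ρ⁻¹ ^ k * ‖iteratedFDeriv ℝ k f (ρ⁻¹ • x)‖ ≤ ρ⁻¹ ^ k * (A * s⁻¹ ^ k) := by gcongr
    _ = _ := by ring

/-- Bounds on partial derivatives give bounds on Fréchet derivatives. -/
theorem of_multiDeriv (hf : ContDiffAt ℝ m f x) (hA : 0 ≤ A) (hs : 0 < s)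
    (h : ∀ α : MultiIndex n, order α ≤ m → |multiDeriv α f x| ≤ A * s⁻¹ ^ order α) :
    JetBound m f x ((n + 1) ^ m * A) s := by
  refine ⟨hf, fun k hk => ?_⟩
  have := norm_iteratedFDeriv_le hf hk (B := A * s⁻¹ ^ k) (by positivity)
    fun α hα => by rw [← hα]; exact h α (hα ▸ hk)
  refine this.trans ?_
  have h1 : (n : ℝ) ^ k ≤ (n + 1) ^ m :=
    calc (n : ℝ) ^ k ≤ (n + 1) ^ k := by gcongr; linarith
      _ ≤ _ := pow_le_pow_right₀ (by linarith [n.cast_nonneg (α := ℝ)]) hk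
  calc (n : ℝ) ^ k * (A * s⁻¹ ^ k) ≤ (n + 1) ^ m * (A * s⁻¹ ^ k) := by gcongr
    _ = _ := by ring

theorem abs_multiDeriv_le (hf : JetBound m f x A s) {α : MultiIndex n} (hα : order α ≤ m) :
    |multiDeriv α f x| ≤ A * s⁻¹ ^ order α :=
  (ImpliedJets.abs_multiDeriv_le hf.1 hα).trans (hf.2 _ hα)

end JetBound

/-! ### Polynomials centred at a point -/

/-- The monomial `(x - y)^γ / γ!`. -/
noncomputable def dividedPow (y : Space n) (γ : MultiIndex n) (x : Space n) : ℝ :=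
  1 / (multiFactorial γ : ℝ) * multiPow (x - y) γ

theorem contDiff_dividedPow (y : Space n) (γ : MultiIndex n) {k : WithTop ℕ∞} :
    ContDiff ℝ k (dividedPow y γ) := by
  unfold dividedPow multiPow
  refine contDiff_const.mul (contDiff_prod fun i _ => ContDiff.pow ?_ _)
  fun_prop

theorem dividedPow_self (y : Space n) (γ : MultiIndex n) :
    dividedPow y γ y = if γ = 0 then 1 else 0 := by
  unfold dividedPow multiPow
  split_ifs with h
  · subst h; simp [multiFactorial]
  · obtain ⟨i, hi⟩ := Function.ne_iff.1 h
    rw [Finset.prod_eq_zero (Finset.mem_univ i), mul_zero]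
    simpa using hi

/-- Dividing by `γ!` turns differentiation into a pure shift of the index. Only the `i`-th factor
varies along the line through `x` in direction `i`. -/
theorem pderiv_dividedPow (y : Space n) (γ : MultiIndex n) (i : Fin n) (x : Space n) :
    pderiv i (dividedPow y γ) x =
      if γ i = 0 then 0 else dividedPow y (γ - Pi.single i 1) x := by
  have hd : DifferentiableAt ℝ (dividedPow y γ) x :=
    (contDiff_dividedPow y γ (k := 1)).contDiffAt.differentiableAt (by norm_num)
  have hline : HasDerivAt (fun t : ℝ => dividedPow y γ (x + t • coordVec i))
      (pderiv i (dividedPow y γ) x) 0 := by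
    have := hd.hasFDerivAt.hasLineDerivAt (coordVec i)
    exact this
  refine hline.unique ?_
  have hsplit : ∀ (δ : MultiIndex n) (z : Space n), dividedPow y δ z =
      (1 / (Nat.factorial (δ i) : ℝ) * (z i - y i) ^ δ i) *
      ∏ j ∈ Finset.univ.erase i, 1 / (Nat.factorial (δ j) : ℝ) * (z j - y j) ^ δ j := by
    intro δ z
    rw [Finset.mul_prod_erase _ (fun j => 1 / (Nat.factorial (δ j) : ℝ) * (z j - y j) ^ δ j)
      (Finset.mem_univ i), Finset.prod_mul_distrib]
    simp [dividedPow, multiFactorial, multiPow]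
  have hfun : (fun t : ℝ => dividedPow y γ (x + t • coordVec i)) = fun t =>
      (1 / (Nat.factorial (γ i) : ℝ) * (x i + t - y i) ^ γ i) *
      ∏ j ∈ Finset.univ.erase i, 1 / (Nat.factorial (γ j) : ℝ) * (x j - y j) ^ γ j := by
    funext t
    rw [hsplit]
    congr 1
    · simp [coordVec]
    · refine Finset.prod_congr rfl fun j hj => ?_
      simp [coordVec, Finset.ne_of_mem_erase hj]
  rw [hfun]
  have hbase : ∀ (a b c w : ℝ) (k : ℕ), HasDerivAt (fun t : ℝ => c * (a + t - b) ^ k * w)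
      (c * (k * (a - b) ^ (k - 1)) * w) 0 := by
    intro a b c w k
    have h0 : HasDerivAt (fun t : ℝ => a + t - b) 1 0 :=
      ((hasDerivAt_id (0 : ℝ)).const_add a).sub_const b
    have h1 := ((h0.fun_pow k).const_mul c).mul_const w
    simpa using h1
  have h2 := hbase (x i) (y i) (1 / (Nat.factorial (γ i) : ℝ))
    (∏ j ∈ Finset.univ.erase i, 1 / (Nat.factorial (γ j) : ℝ) * (x j - y j) ^ γ j) (γ i)
  refine h2.congr_deriv ?_
  symm
  split_ifs with h
  · simp [h]
  · rw [hsplit]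
    congr 1
    · obtain ⟨k, hk⟩ := Nat.exists_eq_succ_of_ne_zero h
      simp only [Pi.sub_apply, Pi.single_eq_same, hk, Nat.succ_eq_add_one, Nat.add_sub_cancel,
        Nat.factorial_succ]
      push_cast
      field_simp
    · refine Finset.prod_congr rfl fun j hj => ?_
      simp [Finset.ne_of_mem_erase hj]

/-- The polynomial `∑_{|γ| ≤ N} c_γ (x - y)^γ / γ!`. -/
noncomputable def polySum (N : ℕ) (c : MultiIndex n → ℝ) (y x : Space n) : ℝ :=
  ∑ γ ∈ multiIndicesLE n N, c γ * dividedPow y γ x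

theorem contDiff_polySum (N : ℕ) (c : MultiIndex n → ℝ) (y : Space n) {k : WithTop ℕ∞} :
    ContDiff ℝ k (polySum N c y) :=
  ContDiff.sum fun γ _ => contDiff_const.mul (contDiff_dividedPow y γ)

theorem polySum_self (N : ℕ) (c : MultiIndex n → ℝ) (y : Space n) : polySum N c y y = c 0 := by
  unfold polySum
  simp only [dividedPow_self, mul_ite, mul_one, mul_zero]
  rw [Finset.sum_ite_eq' (multiIndicesLE n N) 0, if_pos]
  simp [mem_multiIndicesLE, order]

theorem order_add (α β : MultiIndex n) : order (α + β) = order α + order β := by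
  simp [order, Finset.sum_add_distrib]

theorem order_single (i : Fin n) : order (Pi.single i 1 : MultiIndex n) = 1 := by
  simp [order]

/-- Reindex by `γ ↦ γ + e_i`; the indices missed have `γ i = 0`, and their terms have zero
derivative. -/
theorem pderiv_polySum (N : ℕ) (c : MultiIndex n → ℝ) (y : Space n) (i : Fin n) :
    pderiv i (polySum (N + 1) c y) = polySum N (fun γ => c (γ + Pi.single i 1)) y := by
  funext x
  have h1 : pderiv i (polySum (N + 1) c y) x =
      ∑ γ ∈ multiIndicesLE n (N + 1), c γ * pderiv i (dividedPow y γ) x := by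
    have hd : ∀ γ, DifferentiableAt ℝ (dividedPow y γ) x := fun γ =>
      (contDiff_dividedPow y γ (k := 1)).contDiffAt.differentiableAt (by norm_num)
    unfold pderiv polySum
    rw [fderiv_fun_sum fun γ _ => (hd γ).const_mul (c γ)]
    simp only [sum_apply]
    refine Finset.sum_congr rfl fun γ _ => ?_
    rw [fderiv_const_mul (hd γ)]
    rfl
  rw [h1]
  unfold polySum
  symm
  refine Finset.sum_of_injOn (fun γ => γ + Pi.single i 1) ?_ ?_ ?_ ?_
  · intro a _ b _ hab
    exact add_right_cancel hab
  · intro γ hγ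
    rw [Finset.mem_coe, mem_multiIndicesLE] at hγ ⊢
    rw [order_add, order_single]
    omega
  · intro γ hγ hnot
    rw [pderiv_dividedPow, if_pos, mul_zero]
    by_contra hne
    refine hnot ⟨γ - Pi.single i 1, ?_, ?_⟩
    · have hle : Pi.single i 1 ≤ γ := by
        intro j
        by_cases hj : j = i
        · subst hj; simpa using Nat.one_le_iff_ne_zero.2 hne
        · simp [hj]
      have := order_add (γ - Pi.single i 1) (Pi.single i 1)
      rw [tsub_add_cancel_of_le hle, order_single] at this
      rw [mem_multiIndicesLE] at hγ
      rw [Finset.mem_coe, mem_multiIndicesLE]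
      omega
    · refine tsub_add_cancel_of_le ?_
      intro j
      by_cases hj : j = i
      · subst hj; simpa using Nat.one_le_iff_ne_zero.2 hne
      · simp [hj]
  · intro γ _
    rw [pderiv_dividedPow, if_neg (by simp), add_tsub_cancel_right]

theorem pderiv_polySum_zero (c : MultiIndex n → ℝ) (y : Space n) (i : Fin n) (x : Space n) :
    pderiv i (polySum 0 c y) x = 0 := by
  have : polySum 0 c y = fun _ => c 0 := by
    funext z
    have h0 : multiIndicesLE n 0 = {0} := by
      ext γ
      rw [mem_multiIndicesLE, Finset.mem_singleton, Nat.le_zero]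
      constructor
      · intro h
        funext j
        have := (Finset.sum_eq_zero_iff.1 h) j (Finset.mem_univ j)
        exact this
      · rintro rfl; simp [order]
    simp [polySum, h0, dividedPow, multiFactorial, multiPow]
  rw [this]
  simp [pderiv]

theorem listDeriv_polySum (N : ℕ) (c : MultiIndex n → ℝ) (y : Space n) (l : List (Fin n))
    (hl : l.length ≤ N) : listDeriv l (polySum N c y) =
      polySum (N - l.length) (fun γ => c (γ + fun i => l.count i)) y := by
  induction l with
  | nil => simp only [List.count_nil, List.length_nil]; rfl
  | cons i t ih =>
    rw [List.length_cons] at hl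
    change pderiv i (listDeriv t (polySum N c y)) = _
    rw [ih (by omega), List.length_cons]
    obtain ⟨k, hk⟩ : ∃ k, N - t.length = k + 1 := ⟨N - t.length - 1, by omega⟩
    rw [hk, pderiv_polySum, show N - (t.length + 1) = k by omega]
    congr 1
    funext γ
    congr 1
    funext j
    simp only [Pi.add_apply, List.count_cons, Pi.single_apply, beq_iff_eq, eq_comm (a := i)]
    split_ifs <;> omega

theorem multiDeriv_polySum {N : ℕ} (c : MultiIndex n → ℝ) (y : Space n) {α : MultiIndex n}
    (hα : order α ≤ N) :
    multiDeriv α (polySum N c y) = polySum (N - order α) (fun γ => c (α + γ)) y := by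
  rw [multiDeriv_eq_listDeriv, listDeriv_polySum _ _ _ _ (by rwa [length_indexList]),
    length_indexList]
  congr 1
  funext γ
  simp only [count_indexList, add_comm γ]

theorem iteratedFDeriv_polySum_succ (N : ℕ) (c : MultiIndex n → ℝ) (y x : Space n) :
    iteratedFDeriv ℝ (N + 1) (polySum N c y) x = 0 := by
  rw [← norm_le_zero_iff]
  have := norm_iteratedFDeriv_le (m := N + 1) (k := N + 1) (B := 0)
    (contDiff_polySum N c y).contDiffAt (x := x) le_rfl le_rfl fun α hα => ?_
  · simpa using this
  rw [multiDeriv_eq_listDeriv]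
  have hlen : (indexList α).length = N + 1 := by rw [length_indexList, hα]
  obtain ⟨i, t, hit⟩ := List.exists_cons_of_length_eq_add_one hlen
  rw [hit, List.length_cons] at hlen
  rw [hit]
  change |pderiv i (listDeriv t (polySum N c y)) x| ≤ 0
  rw [listDeriv_polySum _ _ _ _ (by omega), show N - t.length = 0 by omega, pderiv_polySum_zero]
  simp

/-- A polynomial of degree at most `m` is controlled near `y` by its derivatives at `y`. -/
theorem JetBound.of_center {q : Space n → ℝ} (hq : ContDiff ℝ (m + 1 : ℕ) q)
    (hq0 : ∀ x, iteratedFDeriv ℝ (m + 1) q x = 0) {y : Space n} {A a s : ℝ} (ha : 0 ≤ a)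
    (hs : 0 < s) (h : JetBound m q y A s) {x : Space n} (hx : ‖x - y‖ ≤ a * s) :
    JetBound m q x ((1 + a) ^ (m + 1) * A) s := by
  have hA := h.nonneg
  -- Descending induction on the order `k`, starting from the vanishing derivative of order `m + 1`.
  -- The mean value inequality bounds order `k` by order `k + 1` and the value at `y`, at the cost
  -- of one factor `1 + a`.
  have main : ∀ j k, k + j = m + 1 → ∀ x, ‖x - y‖ ≤ a * s →
      ‖iteratedFDeriv ℝ k q x‖ ≤ (1 + a) ^ j * A * s⁻¹ ^ k := by
    intro j
    induction j with
    | zero =>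
      intro k hk x _
      obtain rfl : k = m + 1 := by omega
      rw [hq0, norm_zero]
      positivity
    | succ j ih =>
      intro k hk x hx
      have hmv : ‖iteratedFDeriv ℝ k q x - iteratedFDeriv ℝ k q y‖ ≤
          ((1 + a) ^ j * A * s⁻¹ ^ (k + 1)) * ‖x - y‖ := by
        refine (convex_closedBall y (a * s)).norm_image_sub_le_of_norm_fderiv_le (𝕜 := ℝ)
          (fun z _ => ?_) (fun z hz => ?_) ?_ ?_
        · exact hq.contDiffAt.differentiableAt_iteratedFDeriv
            (by exact_mod_cast (by omega : k < m + 1))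
        · rw [norm_fderiv_iteratedFDeriv]
          exact ih (k + 1) (by omega) z (by simpa [dist_eq_norm] using hz)
        · simp; positivity
        · simpa [dist_eq_norm] using hx
      have h0 := h.2 k (by omega)
      have h1 : 1 ≤ (1 + a) ^ j := one_le_pow₀ (by linarith)
      calc ‖iteratedFDeriv ℝ k q x‖
          ≤ ‖iteratedFDeriv ℝ k q y‖ + ‖iteratedFDeriv ℝ k q x - iteratedFDeriv ℝ k q y‖ := by
            simpa using norm_add_le (iteratedFDeriv ℝ k q y)
              (iteratedFDeriv ℝ k q x - iteratedFDeriv ℝ k q y)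
        _ ≤ A * s⁻¹ ^ k + ((1 + a) ^ j * A * s⁻¹ ^ (k + 1)) * (a * s) := by
            refine add_le_add h0 (hmv.trans ?_)
            gcongr
        _ = (1 + a * (1 + a) ^ j) * (A * s⁻¹ ^ k) := by
            rw [pow_succ]; field_simp
        _ ≤ ((1 + a) ^ j + a * (1 + a) ^ j) * (A * s⁻¹ ^ k) := by gcongr
        _ = _ := by ring
  refine ⟨(hq.of_le (by exact_mod_cast Nat.le_succ m)).contDiffAt, fun k hk => ?_⟩
  refine (main (m + 1 - k) k (by omega) x hx).trans ?_
  have : (1 + a) ^ (m + 1 - k) ≤ (1 + a) ^ (m + 1) :=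
    pow_le_pow_right₀ (by linarith) (Nat.sub_le _ _)
  gcongr

/-- The Taylor polynomial of degree `m` of `F` at `y`. -/
noncomputable def taylorPoly (m : ℕ) (F : Space n → ℝ) (y : Space n) : Space n → ℝ :=
  polySum m (fun γ => multiDeriv γ F y) y

theorem multiDeriv_taylorPoly (F : Space n → ℝ) (y x : Space n) {α : MultiIndex n}
    (hα : order α ≤ m) : multiDeriv α (taylorPoly m F y) x =
      ∑ γ ∈ multiIndicesLE n (m - order α),
          1 / (multiFactorial γ : ℝ) * multiDeriv (α + γ) F y * multiPow (x - y) γ := by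
  rw [taylorPoly, multiDeriv_polySum _ _ hα, polySum]
  refine Finset.sum_congr rfl fun γ _ => ?_
  rw [dividedPow]
  ring

theorem multiDeriv_taylorPoly_self (F : Space n → ℝ) (y : Space n) {α : MultiIndex n}
    (hα : order α ≤ m) : multiDeriv α (taylorPoly m F y) y = multiDeriv α F y := by
  rw [taylorPoly, multiDeriv_polySum _ _ hα, polySum_self, add_zero]

theorem multiDeriv_sub {f g : Space n → ℝ} {x : Space n} (hf : ContDiffAt ℝ m f x)
    (hg : ContDiffAt ℝ m g x) {α : MultiIndex n} (hα : order α ≤ m) :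
    multiDeriv α (fun z => f z - g z) x = multiDeriv α f x - multiDeriv α g x := by
  have hl : (indexList α).length ≤ m := by rwa [length_indexList]
  have hk : (((indexList α).length : ℕ) : WithTop ℕ∞) ≤ m := by exact_mod_cast hl
  simp only [multiDeriv_eq_listDeriv]
  rw [listDeriv_eq_iteratedFDeriv _ hf hl, listDeriv_eq_iteratedFDeriv _ hg hl,
    listDeriv_eq_iteratedFDeriv _ (hf.sub hg) hl,
    fun_iteratedFDeriv_sub_apply (hf.of_le hk) (hg.of_le hk)]
  rfl

/-! ### Smooth partitions of unity subordinate to a lattice of balls -/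

theorem JetBound.const (a : ℝ) {x : Space n} {s : ℝ} (hs : 0 < s) :
    JetBound m (fun _ => a) x |a| s := by
  refine ⟨contDiffAt_const, fun k _ => ?_⟩
  rcases Nat.eq_zero_or_pos k with rfl | hk
  · simp
  · rw [iteratedFDeriv_const_of_ne hk.ne']
    simp only [Pi.zero_apply, norm_zero]
    positivity

theorem JetBound.comp_sub {f : Space n → ℝ} {x a : Space n} {A s : ℝ}
    (h : JetBound m f (x - a) A s) : JetBound m (fun y => f (y - a)) x A s := by
  refine ⟨ContDiffAt.comp x h.1 (contDiffAt_id.sub contDiffAt_const), fun k hk => ?_⟩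
  rw [iteratedFDeriv_comp_sub]
  exact h.2 k hk

/-- A bump function on the line whose integer translates sum to `1`. -/
noncomputable def lineBump (t : ℝ) : ℝ :=
  Real.smoothTransition (t + 1) - Real.smoothTransition t

theorem lineBump_eq_zero {t : ℝ} (ht : 1 ≤ |t|) : lineBump t = 0 := by
  unfold lineBump
  rcases le_abs'.1 ht with h | h
  · rw [Real.smoothTransition.zero_of_nonpos (by linarith),
      Real.smoothTransition.zero_of_nonpos (by linarith), sub_zero]
  · rw [Real.smoothTransition.one_of_one_le (by linarith),
      Real.smoothTransition.one_of_one_le h, sub_self]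

/-- The sum telescopes to a difference of two values of the smooth transition, equal to `1` and `0`.
-/
theorem sum_lineBump {M : ℕ} {t : ℝ} (ht : |t| ≤ M) :
    ∑ k ∈ Finset.Ico (-M : ℤ) (M + 1), lineBump (t - k) = 1 := by
  have tele : ∀ (a : ℤ) (N : ℕ), ∑ k ∈ Finset.Ico a (a + N), lineBump (t - k) =
      Real.smoothTransition (t - a + 1) - Real.smoothTransition (t - (a + N) + 1) := by
    intro a N
    induction N with
    | zero => simp
    | succ N ih =>
      push_cast
      rw [← add_assoc, ← Finset.insert_Ico_right_eq_Ico_add_one (by omega),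
        Finset.sum_insert (by simp), ih, lineBump]
      push_cast
      ring_nf
  have := tele (-M) (2 * M + 1)
  rw [show (-M : ℤ) + ((2 * M + 1 : ℕ) : ℤ) = M + 1 by push_cast; ring] at this
  rw [this]
  have h := abs_le.1 ht
  push_cast
  rw [Real.smoothTransition.one_of_one_le (by linarith),
    Real.smoothTransition.zero_of_nonpos (by linarith), sub_zero]

/-- A bump function on `ℝⁿ` whose translates by the integer lattice sum to `1`. -/
noncomputable def latticeBump (u : Space n) : ℝ := ∏ j, lineBump (u j)

theorem contDiff_latticeBump : ContDiff ℝ m (latticeBump : Space n → ℝ) := by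
  unfold latticeBump lineBump
  refine contDiff_prod fun j _ => ?_
  refine ContDiff.sub ?_ ?_
  · exact (Real.smoothTransition.contDiff (n := m)).comp (by fun_prop)
  · exact (Real.smoothTransition.contDiff (n := m)).comp (by fun_prop)

theorem norm_lt_of_abs_coord_le {u : Space n} {c : ℝ} (hc : 0 < c) (h : ∀ j, |u j| ≤ c) :
    ‖u‖ < (n + 1) * c := by
  have h1 : ‖u‖ ^ 2 ≤ n * c ^ 2 := by
    rw [EuclideanSpace.norm_sq_eq]
    calc ∑ j, ‖u j‖ ^ 2 ≤ ∑ _j : Fin n, c ^ 2 := by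
          refine Finset.sum_le_sum fun j _ => ?_
          have := h j
          rw [Real.norm_eq_abs]
          gcongr
      _ = n * c ^ 2 := by simp
  refine lt_of_pow_lt_pow_left₀ 2 (by positivity) (h1.trans_lt ?_)
  have : (0 : ℝ) ≤ n := n.cast_nonneg
  rw [mul_pow]
  have hc2 : 0 < c ^ 2 := by positivity
  refine mul_lt_mul_of_pos_right ?_ hc2
  nlinarith

theorem norm_lt_of_latticeBump_ne_zero {u : Space n} (h : latticeBump u ≠ 0) : ‖u‖ < n + 1 := by
  rw [← mul_one ((n : ℝ) + 1)]
  refine norm_lt_of_abs_coord_le one_pos fun j => ?_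
  by_contra hj
  exact h (Finset.prod_eq_zero (Finset.mem_univ j) (lineBump_eq_zero (not_le.1 hj).le))

theorem exists_jetBound_latticeBump (n m : ℕ) :
    ∃ C > 0, ∀ u : Space n, JetBound m latticeBump u C 1 := by
  have hcs : HasCompactSupport (latticeBump : Space n → ℝ) := by
    refine HasCompactSupport.of_support_subset_isCompact
      (isCompact_closedBall (0 : Space n) (n + 1)) fun u hu => ?_
    simpa using (norm_lt_of_latticeBump_ne_zero hu).le
  have hb : ∀ k : ℕ, ∃ C, k ≤ m → ∀ u : Space n, ‖iteratedFDeriv ℝ k latticeBump u‖ ≤ C := by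
    intro k
    obtain ⟨C, hC⟩ := ((contDiff_latticeBump (n := n) (m := k)).continuous_iteratedFDeriv
      le_rfl).bounded_above_of_compact_support (hcs.iteratedFDeriv k)
    exact ⟨C, fun _ => hC⟩
  choose C hC using hb
  refine ⟨1 + ∑ k ∈ Finset.range (m + 1), |C k|, by positivity, fun u =>
    ⟨contDiff_latticeBump.contDiffAt, fun k hk => ?_⟩⟩
  rw [inv_one, one_pow, mul_one]
  have h1 := Finset.single_le_sum (f := fun k => |C k|) (fun j _ => abs_nonneg (C j))
    (Finset.mem_range.2 (Nat.lt_succ_of_le hk))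
  have h2 := hC k hk u
  have h3 := le_abs_self (C k)
  linarith

/-- A finite smooth partition of unity on the ball of radius `R`, subordinate to balls of radius
`s` with multiplicity at most `N`. -/
structure IsPartition (m : ℕ) (C : ℝ) (N : ℕ) (s R : ℝ) {ι : Type*} (T : Finset ι)
    (z : ι → Space n) (φ : ι → Space n → ℝ) : Prop where
  contDiff : ∀ i, ContDiff ℝ m (φ i)
  jetBound : ∀ i x, JetBound m (φ i) x C s
  norm_lt : ∀ i x, φ i x ≠ 0 → ‖x - z i‖ < s
  sum_eq_one : ∀ x, ‖x‖ < R → ∑ i ∈ T, φ i x = 1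
  card_le : ∀ x, (T.filter fun i => ‖x - z i‖ ≤ s).card ≤ N

/-- Dilate the lattice bump by `h = s / (n + 1)`, so that its support, of radius `n + 1`, shrinks to
radius `s`. An interval of length `2 n + 2` contains at most `2 n + 3` integers, which bounds the
multiplicity coordinatewise. Neither constant depends on `s` or `R`. -/
theorem exists_isPartition (n m : ℕ) : ∃ C > 0, ∃ N : ℕ, ∀ s > 0, ∀ R : ℝ,
    ∃ (T : Finset (Fin n → ℤ)) (z : (Fin n → ℤ) → Space n) (φ : (Fin n → ℤ) → Space n → ℝ),
      IsPartition m C N s R T z φ := by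
  obtain ⟨C, hC, hbump⟩ := exists_jetBound_latticeBump n m
  have hn1 : (0 : ℝ) < n + 1 := by positivity
  refine ⟨(n + 1) ^ m * C, by positivity, (2 * n + 3) ^ n, fun s hs R => ?_⟩
  set h : ℝ := s / (n + 1) with hh
  have hh0 : 0 < h := by positivity
  have hhs : h * (n + 1) = s := by rw [hh]; field_simp
  obtain ⟨M, hM⟩ := exists_nat_ge (R / h)
  let w : (Fin n → ℤ) → Space n := fun i => WithLp.toLp 2 fun j => (i j : ℝ)
  let z : (Fin n → ℤ) → Space n := fun i => h • w i
  let φ : (Fin n → ℤ) → Space n → ℝ := fun i x => latticeBump (h⁻¹ • (x - z i))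
  refine ⟨Fintype.piFinset fun _ => Finset.Ico (-M : ℤ) (M + 1), z, φ, ?_, ?_, ?_, ?_, ?_⟩
  · intro i
    refine contDiff_latticeBump.comp ?_
    fun_prop
  · intro i x
    have h1 : JetBound m (fun y : Space n => latticeBump (h⁻¹ • y)) (x - z i) C (1 * h) :=
      JetBound.comp_smul contDiff_latticeBump hh0 (hbump _)
    rw [one_mul] at h1
    refine h1.comp_sub.rescale (c := n + 1) hh0 hs ?_ (by rw [mul_comm, hhs])
    linarith [n.cast_nonneg (α := ℝ)]
  · intro i x hx
    have := norm_lt_of_latticeBump_ne_zero hx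
    rw [norm_smul, Real.norm_eq_abs, abs_of_pos (inv_pos.2 hh0), inv_mul_lt_iff₀ hh0, hhs] at this
    exact this
  · intro x hx
    have hfac : ∀ i, φ i x = ∏ j, lineBump (h⁻¹ * x j - i j) := by
      intro i
      refine Finset.prod_congr rfl fun j _ => ?_
      congr 1
      simp only [z, w, PiLp.smul_apply, PiLp.sub_apply, smul_eq_mul]
      field_simp
    simp only [hfac]
    rw [← Finset.prod_univ_sum (fun _ => Finset.Ico (-M : ℤ) (M + 1))
      (fun j k => lineBump (h⁻¹ * x j - k))]
    refine Finset.prod_eq_one fun j _ => sum_lineBump ?_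
    rw [abs_mul, abs_of_pos (inv_pos.2 hh0), inv_mul_le_iff₀ hh0]
    have h1 : |x j| ≤ ‖x‖ := PiLp.norm_apply_le x j
    rw [div_le_iff₀ hh0] at hM
    linarith
  · intro x
    have hsub : ((Fintype.piFinset fun _ : Fin n => Finset.Ico (-M : ℤ) (M + 1)).filter
        fun i => ‖x - z i‖ ≤ s) ⊆ Fintype.piFinset fun j : Fin n =>
          Finset.Icc ⌈h⁻¹ * x j - (n + 1)⌉ ⌊h⁻¹ * x j + (n + 1)⌋ := by
      intro i hi
      rw [Finset.mem_filter] at hi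
      rw [Fintype.mem_piFinset]
      intro j
      have h1 : |x j - h * i j| ≤ s := by
        have : |(x - z i) j| ≤ ‖x - z i‖ := PiLp.norm_apply_le (x - z i) j
        exact this.trans hi.2
      have h2 : |h⁻¹ * x j - i j| ≤ n + 1 := by
        have : h⁻¹ * x j - i j = h⁻¹ * (x j - h * i j) := by field_simp
        rw [this, abs_mul, abs_of_pos (inv_pos.2 hh0), inv_mul_le_iff₀ hh0, hhs]
        exact h1
      rw [abs_le] at h2
      rw [Finset.mem_Icc, Int.ceil_le, Int.le_floor]
      constructor <;> linarith
    refine (Finset.card_le_card hsub).trans ?_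
    rw [Fintype.card_piFinset]
    refine (Finset.prod_le_prod' (g := fun _ => 2 * n + 3) fun j _ => ?_).trans (by simp)
    rw [Int.card_Icc, Int.toNat_le]
    have h1 := Int.floor_le (h⁻¹ * x j + (n + 1))
    have h2 := Int.le_ceil (h⁻¹ * x j - (n + 1))
    have h3 : ((⌊h⁻¹ * x j + (n + 1)⌋ : ℤ) : ℝ) - (⌈h⁻¹ * x j - (n + 1)⌉ : ℤ) ≤ 2 * n + 2 := by
      linarith
    have h4 : ⌊h⁻¹ * x j + (n + 1)⌋ - ⌈h⁻¹ * x j - (n + 1)⌉ ≤ 2 * (n : ℤ) + 2 := by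
      exact_mod_cast h3
    push_cast
    omega

namespace IsPartition

variable {ι : Type*} {C : ℝ} {N : ℕ} {s R : ℝ} {T : Finset ι} {z : ι → Space n}
  {φ : ι → Space n → ℝ}

theorem eventually_eq_zero (h : IsPartition m C N s R T z φ) {i : ι} {x : Space n}
    (hx : s < ‖x - z i‖) : ∀ᶠ y in 𝓝 x, φ i y = 0 := by
  have hc : Continuous fun y => ‖y - z i‖ := by fun_prop
  filter_upwards [hc.continuousAt.eventually (lt_mem_nhds hx)] with y hy
  by_contra h0
  exact absurd (h.norm_lt i y h0) (not_lt.2 hy.le)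

/-- Terms whose centre is farther than `s` from `x` vanish in a whole neighbourhood of `x`, so at
most `N` terms contribute, however large `T` is. -/
theorem jetBound_sum (h : IsPartition m C N s R T z φ) (hs : 0 < s) {g : ι → Space n → ℝ}
    {x : Space n} {B : ℝ} (hB : 0 ≤ B) (hg : ∀ i ∈ T, ‖x - z i‖ ≤ s → JetBound m (g i) x B s)
    (hC : 0 ≤ C) : JetBound m (fun y => ∑ i ∈ T, φ i y * g i y) x (N * (2 ^ m * C * B)) s := by
  classical
  have h1 : ∀ i ∈ T, JetBound m (fun y => φ i y * g i y) x
      (if ‖x - z i‖ ≤ s then 2 ^ m * C * B else 0) s := by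
    intro i hi
    split_ifs with hx
    · exact (h.jetBound i x).mul (hg i hi hx) hs
    · refine (JetBound.zero le_rfl hs).congr ?_
      filter_upwards [h.eventually_eq_zero (not_le.1 hx)] with y hy
      rw [hy, zero_mul]
  refine (JetBound.sum hs h1).mono hs ?_
  rw [← Finset.sum_filter, Finset.sum_const, nsmul_eq_mul]
  have := h.card_le x
  gcongr

end IsPartition

/-- Add the pieces of a partition at scale `s / 16` whose centres lie within `13/16 s` of `E`. As
`3/4 + 1/16 = 13/16 = 7/8 - 1/16`, every piece active at a point within `3/4 s` is included, and
none active beyond `7/8 s` is. -/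
theorem exists_cutoff (n m : ℕ) : ∃ C > 0, ∀ E : Set (Space n), E.Nonempty →
    Bornology.IsBounded E → ∀ s > 0, ∃ χ : Space n → ℝ, (∀ x, JetBound m χ x C s) ∧
      (∀ x, Metric.infDist x E ≤ 3 / 4 * s → χ x = 1) ∧
      (∀ x, 7 / 8 * s ≤ Metric.infDist x E → χ x = 0) := by
  classical
  obtain ⟨C, hC, N, hpart⟩ := exists_isPartition n m
  refine ⟨16 ^ m * (N * (2 ^ m * C * 1)) + 1, by positivity, fun E hE hEb s hs => ?_⟩
  obtain ⟨R, hR⟩ := (hEb.cthickening (δ := s)).subset_ball 0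
  obtain ⟨T, z, φ, hφ⟩ := hpart (s / 16) (by positivity) R
  have hlip : ∀ x y, Metric.infDist x E ≤ Metric.infDist y E + ‖x - y‖ := fun x y => by
    rw [← dist_eq_norm]; exact Metric.infDist_le_infDist_add_dist
  let c : (Fin n → ℤ) → ℝ := fun i => if Metric.infDist (z i) E < 13 / 16 * s then 1 else 0
  refine ⟨fun x => ∑ i ∈ T, φ i x * c i, fun x => ?_, fun x hx => ?_, fun x hx => ?_⟩
  · have h1 := hφ.jetBound_sum (x := x) (by positivity) (g := fun i _ => c i) zero_le_one
      (fun i _ _ => (JetBound.const (c i) (by positivity)).mono (by positivity) (by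
        simp only [c]; split_ifs <;> simp)) hC.le
    refine (h1.rescale (c := 16) (t := s) (by positivity) hs (by norm_num) (by linarith)).mono hs
      (by linarith)
  · have hxR : ‖x‖ < R := by
      have : x ∈ Metric.ball (0 : Space n) R := hR (by
        rw [Metric.mem_cthickening_iff, ← ENNReal.ofReal_toReal (Metric.infEDist_ne_top hE)]
        exact ENNReal.ofReal_le_ofReal (by change Metric.infDist x E ≤ s; linarith))
      simpa using this
    rw [← hφ.sum_eq_one x hxR]
    refine Finset.sum_congr rfl fun i _ => ?_
    by_cases h0 : φ i x = 0
    · simp [h0]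
    · have h1 := hφ.norm_lt i x h0
      have h2 := hlip (z i) x
      rw [norm_sub_rev] at h2
      simp only [c]
      rw [if_pos (by linarith), mul_one]
  · refine Finset.sum_eq_zero fun i _ => ?_
    by_cases h0 : φ i x = 0
    · simp [h0]
    · have h1 := hφ.norm_lt i x h0
      have h2 := hlip x (z i)
      simp only [c]
      rw [if_neg (by linarith), mul_zero]

/-! ### Extension of Whitney fields at a finite scale -/

/-- Average the jets `P (y i)` at almost nearest points of `E` to the centres. Since the weights sum
to `1`, subtracting `P y'` leaves an average of the differences `P (y i) - P y'`, which are small by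
hypothesis. -/
theorem exists_approximation (n m : ℕ) : ∃ C > 0, ∀ E : Set (Space n), E.Nonempty →
    Bornology.IsBounded E → ∀ (P : Space n → Space n → ℝ) (κ s : ℝ), 0 ≤ κ → 0 < s →
    (∀ y ∈ E, ∀ y' ∈ E, ∀ x, ‖x - y‖ ≤ 16 * s → ‖x - y'‖ ≤ 16 * s →
      JetBound m (fun w => P y w - P y' w) x (κ * s ^ m) s) →
    ∃ f : Space n → ℝ, ∀ x, Metric.infDist x E < 2 * s → ∀ y ∈ E, ‖x - y‖ ≤ 4 * s →
      JetBound m (fun w => f w - P y w) x (C * κ * s ^ m) s := by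
  obtain ⟨C, hC, N, hpart⟩ := exists_isPartition n m
  refine ⟨N * (2 ^ m * C) + 1, by positivity, fun E hE hEb P κ s hκ hs hP => ?_⟩
  obtain ⟨R, hR⟩ := (hEb.thickening (δ := 2 * s)).subset_ball 0
  obtain ⟨T, z, φ, hφ⟩ := hpart s hs R
  have hnear : ∀ i, ∃ y ∈ E, dist (z i) y < Metric.infDist (z i) E + s := fun i =>
    (Metric.infDist_lt_iff hE).1 (by linarith)
  choose y hyE hy using hnear
  refine ⟨fun x => ∑ i ∈ T, φ i x * P (y i) x, fun x hx y' hy' hxy' => ?_⟩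
  have hxR : x ∈ Metric.ball (0 : Space n) R := by
    refine hR ((Metric.mem_thickening_iff).2 ?_)
    exact (Metric.infDist_lt_iff hE).1 hx
  have hsum := hφ.jetBound_sum (x := x) hs (g := fun i w => P (y i) w - P y' w)
    (B := κ * s ^ m) (by positivity) (fun i _ hi => hP _ (hyE i) _ hy' x ?_ (by linarith)) hC.le
  · refine (hsum.congr ?_).mono hs ?_
    · filter_upwards [Metric.isOpen_ball.mem_nhds hxR] with w hw
      have h1 := hφ.sum_eq_one w (by simpa using hw)
      calc ∑ i ∈ T, φ i w * P (y i) w - P y' w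
          = ∑ i ∈ T, φ i w * P (y i) w - (∑ i ∈ T, φ i w) * P y' w := by rw [h1, one_mul]
        _ = _ := by
          rw [Finset.sum_mul, ← Finset.sum_sub_distrib]
          simp only [mul_sub]
    · have : 0 ≤ κ * s ^ m := by positivity
      calc _ = (N * (2 ^ m * C)) * (κ * s ^ m) := by ring
        _ ≤ (N * (2 ^ m * C) + 1) * (κ * s ^ m) := by gcongr; linarith
        _ = _ := by ring
  -- The chain `x`, centre, `y i` has length less than `s + (2 s + s + s) = 5 s`, well within `16
  -- s`.
  · have h1 := hy i
    have h2 : Metric.infDist (z i) E ≤ Metric.infDist x E + dist (z i) x :=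
      Metric.infDist_le_infDist_add_dist
    have h3 : dist x (y i) ≤ dist x (z i) + dist (z i) (y i) := dist_triangle _ _ _
    rw [dist_comm (z i) x] at h2
    rw [← dist_eq_norm] at hi ⊢
    linarith

/-- Gluing functions which approximate a family of jets on successive dyadic scales. -/
theorem exists_glue (n m : ℕ) : ∃ C > 0, ∀ E : Set (Space n), E.Nonempty →
    Bornology.IsBounded E → ∀ (P : Space n → Space n → ℝ) (f : ℕ → Space n → ℝ) (κ s : ℝ) (N : ℕ),
    0 ≤ κ → 0 < s →
    (∀ y ∈ E, ∀ x, ‖x - y‖ ≤ 2 * (s * 2 ^ N) →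
      JetBound m (P y) x (κ * (s * 2 ^ N) ^ m) (s * 2 ^ N)) →
    (∀ i ≤ N, ∀ x, Metric.infDist x E < 2 * (s * 2 ^ i) → ∀ y ∈ E, ‖x - y‖ ≤ 4 * (s * 2 ^ i) →
      JetBound m (fun w => f i w - P y w) x (κ * (s * 2 ^ i) ^ m) (s * 2 ^ i)) →
    ∃ H : Space n → ℝ,
      (∀ x, Metric.infDist x E < 2 * (s * 2 ^ N) →
        JetBound m H x (C * κ * (s * 2 ^ N) ^ m) (s * 2 ^ N)) ∧
      (∀ x, Metric.infDist x E < s / 2 → H x = f 0 x) ∧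
      (∀ x, s * 2 ^ N / 2 < Metric.infDist x E → H x = f N x) := by
  obtain ⟨C, hC, hcut⟩ := exists_cutoff n m
  refine ⟨2 ^ m * (2 ^ m * C) * 2 + 2, by positivity, fun E hE hEb P f κ s N hκ hs hP hf => ?_⟩
  set ρ := s * 2 ^ N with hρdef
  have hρ : 0 < ρ := by positivity
  have hD2 : (2 : ℝ) ≤ 2 ^ m * (2 ^ m * C) * 2 + 2 := by
    have : 0 < 2 ^ m * (2 ^ m * C) * 2 := by positivity
    linarith
  have hsi : ∀ i ≤ N, s * 2 ^ i ≤ ρ := fun i hi => by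
    have : (2 : ℝ) ^ i ≤ 2 ^ N := pow_le_pow_right₀ (by norm_num) hi
    rw [hρdef]; gcongr
  have hd : Continuous fun x => Metric.infDist x E := Metric.continuous_infDist_pt E
  have hlevel : ∀ i ≤ N, ∀ x, Metric.infDist x E < 2 * (s * 2 ^ i) →
      JetBound m (f i) x (2 * κ * ρ ^ m) ρ := by
    intro i hi x hx
    obtain ⟨y, hy, hxy⟩ := (Metric.infDist_lt_iff hE).1 hx
    have hsi0 : 0 < s * 2 ^ i := by positivity
    rw [dist_eq_norm] at hxy
    have h1 := (hf i hi x hx y hy (by linarith)).enlarge hsi0 (hsi i hi)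
    have h2 := hP y hy x (by linarith [hsi i hi])
    refine ((h1.add h2).congr (Eventually.of_forall fun w => ?_)).mono hρ (by linarith)
    simp
  -- The passage from `f i` to `f (i + 1)` takes place at distances between `3/4` and `7/8` of `s *
  -- 2 ^ i` from `E`. There the last clause of the invariant gives `H = f i`, so only two
  -- consecutive functions meet, and the constant does not grow with `i`.
  have main : ∀ i ≤ N, ∃ H : Space n → ℝ,
      (∀ x, Metric.infDist x E < 2 * (s * 2 ^ i) →
        JetBound m H x ((2 ^ m * (2 ^ m * C) * 2 + 2) * κ * ρ ^ m) ρ) ∧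
      (∀ x, Metric.infDist x E < s / 2 → H x = f 0 x) ∧
      (∀ x, s * 2 ^ i / 2 < Metric.infDist x E → H x = f i x) := by
    intro i
    induction i with
    | zero =>
      intro hi
      exact ⟨f 0, fun x hx => (hlevel 0 hi x hx).mono hρ (by gcongr), fun _ _ => rfl,
        fun _ _ => rfl⟩
    | succ i ih =>
      intro hi
      obtain ⟨H, hHb, hH0, hHi⟩ := ih (by omega)
      have hpos : 0 < s * 2 ^ i := by positivity
      obtain ⟨χ, hχb, hχ1, hχ0⟩ := hcut E hE hEb (s * 2 ^ i) hpos
      have h2 : s * 2 ^ (i + 1) = 2 * (s * 2 ^ i) := by ring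
      have h1i : s ≤ s * 2 ^ i := by
        have : (1 : ℝ) ≤ 2 ^ i := one_le_pow₀ (by norm_num)
        nlinarith
      refine ⟨fun x => f (i + 1) x + χ x * (H x - f (i + 1) x), fun x hx => ?_, fun x hx => ?_,
        fun x hx => ?_⟩
      · by_cases hA : Metric.infDist x E < 3 / 4 * (s * 2 ^ i)
        · refine (hHb x (by linarith)).congr ?_
          filter_upwards [hd.continuousAt.eventually (gt_mem_nhds hA)] with w hw
          rw [hχ1 w hw.le]; ring
        · rw [not_lt] at hA
          have hfi := hlevel (i + 1) hi x hx
          by_cases hB : Metric.infDist x E < s * 2 ^ i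
          · obtain ⟨y, hy, hxy⟩ := (Metric.infDist_lt_iff hE).1 hB
            rw [dist_eq_norm] at hxy
            have hn := hf (i + 1) hi x hx y hy (by rw [h2]; linarith)
            have ho := (hf i (by omega) x (by linarith) y hy (by linarith)).enlarge hpos
              (t := s * 2 ^ (i + 1)) (by linarith)
            have hχx := (hχb x).rescale (c := 2) (t := s * 2 ^ (i + 1)) hpos (by positivity)
              (by norm_num) h2.le
            -- The difference `f i - f (i + 1)` is estimated through their common approximation `P
            -- y`.
            have hprod := hχx.mul (ho.sub hn) (by positivity)
            have hprod' : JetBound m (fun w => χ w * (H w - f (i + 1) w)) x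
                ((2 ^ m * (2 ^ m * C) * 2) * κ * (s * 2 ^ (i + 1)) ^ m) (s * 2 ^ (i + 1)) := by
              refine (hprod.congr ?_).mono (by positivity) (by apply le_of_eq; ring)
              filter_upwards [hd.continuousAt.eventually
                (lt_mem_nhds (show s * 2 ^ i / 2 < Metric.infDist x E by linarith))] with w hw
              rw [hHi w hw]; ring
            refine (hfi.add (hprod'.enlarge (by positivity) (hsi _ hi))).mono hρ ?_
            apply le_of_eq; ring
          · rw [not_lt] at hB
            refine (hfi.mono hρ (by gcongr)).congr ?_
            filter_upwards [hd.continuousAt.eventually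
              (lt_mem_nhds (show 7 / 8 * (s * 2 ^ i) < Metric.infDist x E by linarith))] with w hw
            rw [hχ0 w hw.le]; ring
      · beta_reduce
        rw [hχ1 x (by linarith), ← hH0 x hx]; ring
      · beta_reduce
        rw [hχ0 x (by linarith)]; ring
  exact main N le_rfl

/-- A `C^m` function satisfying Whitney's estimates with constant `κ` near a bounded set `E`
coincides near `E` with a function on `ℝⁿ` whose derivatives are bounded in terms of `κ`. -/
theorem exists_extension (n m : ℕ) : ∃ C > 0, ∀ E : Set (Space n), E.Nonempty →
    Bornology.IsBounded E → ∀ (P : Space n → Space n → ℝ) (F : Space n → ℝ) (κ s : ℝ) (N : ℕ),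
    0 ≤ κ → 0 < s →
    (∀ y ∈ E, ∀ y' ∈ E, ∀ t > 0, ∀ x, ‖x - y‖ ≤ 16 * t → ‖x - y'‖ ≤ 16 * t →
      JetBound m (fun w => P y w - P y' w) x (κ * t ^ m) t) →
    (∀ y ∈ E, ∀ x, ‖x - y‖ ≤ 4 * (s * 2 ^ (N + 1)) →
      JetBound m (P y) x (κ * (s * 2 ^ (N + 1)) ^ m) (s * 2 ^ (N + 1))) →
    (∀ y ∈ E, ∀ x, ‖x - y‖ ≤ 4 * s → JetBound m (fun w => F w - P y w) x (κ * s ^ m) s) →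
    ∃ G : Space n → ℝ,
      (∀ x, JetBound m G x (C * κ * (s * 2 ^ (N + 1)) ^ m) (s * 2 ^ (N + 1))) ∧
      ∀ x, Metric.infDist x E < s / 2 → G x = F x := by
  obtain ⟨A, hA, happ⟩ := exists_approximation n m
  obtain ⟨C, hC, hglue⟩ := exists_glue n m
  refine ⟨C * (A + 1), by positivity, fun E hE hEb P F κ s N hκ hs hP hP0 hF => ?_⟩
  have hκA : κ ≤ (A + 1) * κ := by nlinarith
  have hmid : ∀ i : ℕ, ∃ f : Space n → ℝ, ∀ x, Metric.infDist x E < 2 * (s * 2 ^ i) → ∀ y ∈ E,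
      ‖x - y‖ ≤ 4 * (s * 2 ^ i) →
      JetBound m (fun w => f w - P y w) x (A * κ * (s * 2 ^ i) ^ m) (s * 2 ^ i) := fun i =>
    happ E hE hEb P κ (s * 2 ^ i) hκ (by positivity) fun y hy y' hy' x =>
      hP y hy y' hy' _ (by positivity) x
  choose g hg using hmid
  -- `F` itself serves at the finest scale, averages in between, and `0` at the coarsest, where the
  -- jets `P y` are already small. The top index is `N + 1` so that the two ends never coincide.
  let f : ℕ → Space n → ℝ := fun i => if i = 0 then F else if i = N + 1 then 0 else g i
  have hρ : 0 < s * 2 ^ (N + 1) := by positivity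
  obtain ⟨H, hHb, hH0, hHN⟩ := hglue E hE hEb P f ((A + 1) * κ) s (N + 1) (by positivity) hs
    (fun y hy x hx => (hP0 y hy x (by linarith)).mono hρ (by gcongr)) (by
      intro i hi x hx y hy hxy
      simp only [f]
      split_ifs with h0 h1
      · subst h0
        simp only [pow_zero, mul_one] at hxy ⊢
        exact (hF y hy x hxy).mono hs (by gcongr)
      · subst h1
        refine ((hP0 y hy x hxy).neg.mono hρ (by gcongr)).congr
          (Eventually.of_forall fun w => ?_)
        simp
      · refine (hg i x hx y hy hxy).mono (by positivity) ?_
        gcongr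
        linarith)
  refine ⟨H, fun x => ?_, fun x hx => ?_⟩
  · rw [mul_assoc C]
    by_cases hx : Metric.infDist x E < 2 * (s * 2 ^ (N + 1))
    · exact hHb x hx
    · rw [not_lt] at hx
      refine (JetBound.zero (by positivity) hρ).congr ?_
      filter_upwards [(Metric.continuous_infDist_pt E).continuousAt.eventually
        (lt_mem_nhds (show s * 2 ^ (N + 1) / 2 < Metric.infDist x E by linarith))] with w hw
      rw [hHN w hw]
      simp [f]
  · rw [hH0 x hx]
    simp [f]

/-! ### Whitney estimates in terms of Taylor polynomials -/

theorem contDiff_taylorPoly (F : Space n → ℝ) (y : Space n) {k : WithTop ℕ∞} :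
    ContDiff ℝ k (taylorPoly m F y) :=
  contDiff_polySum _ _ _

theorem mul_pow_sub_le {ε d a t : ℝ} (hε : 0 ≤ ε) (hd : 0 ≤ d) (ha : 1 ≤ a) (ht : 0 < t)
    (h : d ≤ a * t) {k : ℕ} (hk : k ≤ m) : ε * d ^ (m - k) ≤ ε * a ^ m * t ^ m * t⁻¹ ^ k := by
  have h1 : d ^ (m - k) ≤ (a * t) ^ (m - k) := by gcongr
  have h2 : a ^ (m - k) ≤ a ^ m := pow_le_pow_right₀ ha (Nat.sub_le _ _)
  have h3 : t ^ m * t⁻¹ ^ k = t ^ (m - k) := by rw [inv_pow, ← pow_sub₀ t ht.ne' hk]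
  calc ε * d ^ (m - k) ≤ ε * (a * t) ^ (m - k) := by gcongr
    _ = ε * (a ^ (m - k) * t ^ (m - k)) := by rw [mul_pow]
    _ ≤ ε * (a ^ m * t ^ (m - k)) := by gcongr
    _ = _ := by rw [← h3]; ring

/-- The estimates defining negligible functions, on the set `W`. -/
structure WhitneyBound (m : ℕ) (ε : ℝ) (W : Set (Space n)) (F : Space n → ℝ) : Prop where
  contDiffAt : ∀ x ∈ W, ContDiffAt ℝ m F x
  bound : ∀ x ∈ W, ∀ α : MultiIndex n, order α ≤ m →
    |multiDeriv α F x| ≤ ε * ‖x‖ ^ (m - order α)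
  remainder : ∀ x ∈ W, ∀ y ∈ W, x ≠ y → ∀ α : MultiIndex n, order α ≤ m →
    |multiDeriv α F x - ∑ γ ∈ multiIndicesLE n (m - order α),
        1 / (multiFactorial γ : ℝ) * multiDeriv (α + γ) F y * multiPow (x - y) γ| ≤
      ε * ‖x - y‖ ^ (m - order α)

namespace WhitneyBound

variable {ε : ℝ} {W : Set (Space n)} {F : Space n → ℝ}

theorem jetBound_sub (h : WhitneyBound m ε W F) (hε : 0 ≤ ε) {x y : Space n} (hx : x ∈ W)
    (hy : y ∈ W) {a t : ℝ} (ha : 1 ≤ a) (ht : 0 < t) (hxy : ‖x - y‖ ≤ a * t) :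
    JetBound m (fun w => F w - taylorPoly m F y w) x ((n + 1) ^ m * (ε * a ^ m * t ^ m)) t := by
  have hT : ContDiffAt ℝ m (taylorPoly m F y) x := (contDiff_taylorPoly F y).contDiffAt
  refine JetBound.of_multiDeriv ((h.contDiffAt x hx).sub hT) (by positivity) ht fun α hα => ?_
  rw [multiDeriv_sub (h.contDiffAt x hx) hT hα]
  by_cases hne : x = y
  · subst hne
    rw [multiDeriv_taylorPoly_self F x hα, sub_self, abs_zero]
    positivity
  · rw [multiDeriv_taylorPoly F y x hα]
    exact (h.remainder x hx y hy hne α hα).trans (mul_pow_sub_le hε (norm_nonneg _) ha ht hxy hα)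

/-- At `y'` the difference is `(F - T_{y'}) - (F - T_y)`, which the remainder estimate controls
since `|y' - y| ≤ 32 t`. Being a polynomial of degree at most `m`, it stays controlled at `x`. -/
theorem jetBound_taylorPoly_sub (h : WhitneyBound m ε W F) (hε : 0 ≤ ε) {x y y' : Space n}
    (hy : y ∈ W) (hy' : y' ∈ W) {t : ℝ} (ht : 0 < t) (hxy : ‖x - y‖ ≤ 16 * t)
    (hxy' : ‖x - y'‖ ≤ 16 * t) :
    JetBound m (fun w => taylorPoly m F y w - taylorPoly m F y' w) x
      (((1 + 16) ^ (m + 1) * (2 * (n + 1) ^ m * 32 ^ m)) * ε * t ^ m) t := by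
  have hyy : ‖y' - y‖ ≤ 32 * t := by
    have := norm_sub_le_norm_sub_add_norm_sub y' x y
    rw [norm_sub_rev y' x] at this
    linarith
  have h1 := h.jetBound_sub hε hy' hy (a := 32) (by norm_num) ht hyy
  have h2 := h.jetBound_sub hε hy' hy' (a := 32) (by norm_num) ht (by simp; positivity)
  have h3 : JetBound m (fun w => taylorPoly m F y w - taylorPoly m F y' w) y'
      (2 * (n + 1) ^ m * 32 ^ m * ε * t ^ m) t :=
    ((h2.sub h1).congr (Eventually.of_forall fun w => by ring)).mono ht (by apply le_of_eq; ring)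
  refine (JetBound.of_center ?_ ?_ (a := 16) (by norm_num) ht h3 hxy').mono ht
    (by apply le_of_eq; ring)
  · exact (contDiff_taylorPoly F y).sub (contDiff_taylorPoly F y')
  · intro w
    rw [fun_iteratedFDeriv_sub_apply (contDiff_taylorPoly F y).contDiffAt
      (contDiff_taylorPoly F y').contDiffAt, taylorPoly, taylorPoly, iteratedFDeriv_polySum_succ,
      iteratedFDeriv_polySum_succ, sub_zero]

theorem jetBound_taylorPoly (h : WhitneyBound m ε W F) (hε : 0 ≤ ε) {x y : Space n}
    (hy : y ∈ W) {t : ℝ} (ht : 0 < t) (hyt : ‖y‖ ≤ 4 * t) (hxy : ‖x - y‖ ≤ 4 * t) :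
    JetBound m (taylorPoly m F y) x
      (((1 + 4) ^ (m + 1) * ((n + 1) ^ m * 4 ^ m)) * ε * t ^ m) t := by
  have h3 : JetBound m (taylorPoly m F y) y ((n + 1) ^ m * (ε * 4 ^ m * t ^ m)) t := by
    refine JetBound.of_multiDeriv (contDiff_taylorPoly F y).contDiffAt (by positivity) ht
      fun α hα => ?_
    rw [multiDeriv_taylorPoly_self F y hα]
    exact (h.bound y hy α hα).trans
      (mul_pow_sub_le hε (norm_nonneg _) (by norm_num) ht hyt hα)
  exact (JetBound.of_center (contDiff_taylorPoly F y)
    (fun w => iteratedFDeriv_polySum_succ _ _ _ _) (by norm_num) ht h3 hxy).mono ht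
    (by apply le_of_eq; ring)

end WhitneyBound

/-- A function satisfying Whitney's estimates near `E` can be modified away from `E` so as to have
small derivatives on all of `ℝⁿ`. -/
theorem exists_extension_of_whitneyBound (n m : ℕ) : ∃ C > 0, ∀ (E W : Set (Space n))
    (F : Space n → ℝ) (ε s : ℝ) (N : ℕ), E.Nonempty → 0 ≤ ε → 0 < s →
    (∀ y ∈ E, ‖y‖ ≤ 4 * (s * 2 ^ (N + 1))) → (∀ y ∈ E, ∀ x, ‖x - y‖ ≤ 4 * s → x ∈ W) →
    WhitneyBound m ε W F →
    ∃ G : Space n → ℝ,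
      (∀ x, JetBound m G x (C * ε * (s * 2 ^ (N + 1)) ^ m) (s * 2 ^ (N + 1))) ∧
      ∀ x, Metric.infDist x E < s / 2 → G x = F x := by
  obtain ⟨C, hC, hext⟩ := exists_extension n m
  set K1 : ℝ := (1 + 16) ^ (m + 1) * (2 * (n + 1) ^ m * 32 ^ m) with hK1
  set K2 : ℝ := (1 + 4) ^ (m + 1) * ((n + 1) ^ m * 4 ^ m) with hK2
  set K3 : ℝ := (n + 1) ^ m * 4 ^ m with hK3
  have h1 : 0 < K1 := by positivity
  have h2 : 0 < K2 := by positivity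
  have h3 : 0 < K3 := by positivity
  refine ⟨C * (K1 + K2 + K3), by positivity, fun E W F ε s N hE hε hs hbd hEW hF => ?_⟩
  have hEW' : ∀ y ∈ E, y ∈ W := fun y hy => hEW y hy y (by simp; positivity)
  have hρ : 0 < s * 2 ^ (N + 1) := by positivity
  have hEb : Bornology.IsBounded E := (Metric.isBounded_closedBall (x := (0 : Space n))
    (r := 4 * (s * 2 ^ (N + 1)))).subset fun y hy => by simpa using hbd y hy
  obtain ⟨G, hG, hGF⟩ := hext E hE hEb (taylorPoly m F) F ((K1 + K2 + K3) * ε) s N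
    (by positivity) hs
    (fun y hy y' hy' t ht x hx hx' => (hF.jetBound_taylorPoly_sub hε (hEW' y hy) (hEW' y' hy')
      ht hx hx').mono ht (by gcongr; linarith))
    (fun y hy x hx => (hF.jetBound_taylorPoly hε (hEW' y hy) hρ (hbd y hy) hx).mono hρ
      (by gcongr; linarith))
    (fun y hy x hx => (hF.jetBound_sub hε (hEW y hy x hx) (hEW' y hy) (by norm_num) hs hx).mono hs
      (by
        calc _ = K3 * ε * s ^ m := by rw [hK3]; ring
          _ ≤ _ := by gcongr; linarith))
  refine ⟨G, fun x => ?_, hGF⟩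
  rw [mul_assoc C]
  exact hG x

/-! ### Directions -/

/-- Compare both with `t⁻¹ • x`: the change of radius and the change of position each cost `‖x - t •
ω‖ / t`. -/
theorem norm_normalize_sub_le {x ω : Space n} (hω : ‖ω‖ = 1) {t : ℝ} (ht : 0 < t) (hx : x ≠ 0) :
    ‖‖x‖⁻¹ • x - ω‖ ≤ 2 * ‖x - t • ω‖ / t := by
  have hx0 : 0 < ‖x‖ := norm_pos_iff.2 hx
  have h1 : ‖‖x‖⁻¹ • x - t⁻¹ • x‖ ≤ ‖x - t • ω‖ / t := by
    rw [← sub_smul, norm_smul, Real.norm_eq_abs, inv_sub_inv hx0.ne' ht.ne', abs_div,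
      abs_of_pos (mul_pos hx0 ht), div_mul_eq_mul_div, mul_comm ‖x‖ t,
      mul_div_mul_right _ _ hx0.ne']
    have : |t - ‖x‖| ≤ ‖x - t • ω‖ := by
      have h := abs_norm_sub_norm_le x (t • ω)
      rw [norm_smul, hω, mul_one, Real.norm_eq_abs, abs_of_pos ht, abs_sub_comm] at h
      exact h
    gcongr
  have h2 : ‖t⁻¹ • x - ω‖ = ‖x - t • ω‖ / t := by
    have : t⁻¹ • x - ω = t⁻¹ • (x - t • ω) := by
      rw [smul_sub, smul_smul, inv_mul_cancel₀ ht.ne', one_smul]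
    rw [this, norm_smul, Real.norm_eq_abs, abs_of_pos (inv_pos.2 ht), inv_mul_eq_div]
  calc _ ≤ ‖‖x‖⁻¹ • x - t⁻¹ • x‖ + ‖t⁻¹ • x - ω‖ := norm_sub_le_norm_sub_add_norm_sub _ _ _
    _ ≤ ‖x - t • ω‖ / t + ‖x - t • ω‖ / t := by rw [h2]; gcongr
    _ = _ := by ring

theorem norm_sub_norm_smul (x ω : Space n) : ‖x - ‖x‖ • ω‖ = ‖x‖ * ‖‖x‖⁻¹ • x - ω‖ := by
  rcases eq_or_ne x 0 with rfl | hx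
  · simp
  have hx0 : 0 < ‖x‖ := norm_pos_iff.2 hx
  have : x - ‖x‖ • ω = ‖x‖ • (‖x‖⁻¹ • x - ω) := by
    rw [smul_sub, smul_smul, mul_inv_cancel₀ hx0.ne', one_smul]
  rw [this, norm_smul, norm_norm]

theorem isOpen_directed_cone (V : Set (Space n)) (hV : IsOpen V) :
    IsOpen {x : Space n | x ≠ 0 ∧ ‖x‖⁻¹ • x ∈ V} := by
  have hc : ContinuousOn (fun x : Space n => ‖x‖⁻¹ • x) {x | x ≠ 0} :=
    (continuous_norm.continuousOn.inv₀ fun x hx => norm_ne_zero_iff.2 hx).smul continuousOn_id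
  exact hc.isOpen_inter_preimage isOpen_ne hV

theorem isOpen_cone (Ω : Set (Space n)) (δ r : ℝ) : IsOpen (cone Ω δ r) := by
  have h : cone Ω δ r = {x : Space n | x ≠ 0 ∧ ‖x‖⁻¹ • x ∈ Metric.thickening δ Ω} ∩
      {x | ‖x‖ < r} := by
    ext x
    simp only [cone, Set.mem_inter_iff, Set.mem_ofPred_eq, norm_pos_iff]
    tauto
  rw [h]
  exact (isOpen_directed_cone _ Metric.isOpen_thickening).inter
    (isOpen_lt continuous_norm continuous_const)

/-- Being forbidden is an open condition: a cone witnessing it for `ω` contains the cone of half the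
aperture about every direction close to `ω`. -/
theorem isClosed_allow (m : ℕ) (I : AddSubgroup (MvPolynomial (Fin n) ℝ)) :
    IsClosed (Allow m I) := by
  have h : Allow m I = Directions n ∩ {ω | ∃ (L : ℕ) (p : Fin L → MvPolynomial (Fin n) ℝ),
      (∀ l, p l ∈ I) ∧ IsForbiddenFor m p ω}ᶜ := by
    ext ω; rfl
  rw [h]
  refine Metric.isClosed_sphere.inter (isClosed_compl_iff.2 (Metric.isOpen_iff.2 ?_))
  rintro ω ⟨L, p, hp, c, hc, δ, hδ, r, hr, hx⟩
  refine ⟨δ / 2, by positivity, fun ω' hω' => ⟨L, p, hp, c, hc, δ / 2, by positivity, r, hr,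
    fun x hxc => hx x ⟨hxc.1, hxc.2.1, ?_⟩⟩⟩
  have h1 := hxc.2.2
  rw [Metric.thickening_singleton, Metric.mem_ball] at h1 ⊢
  rw [Metric.mem_ball] at hω'
  linarith [dist_triangle (‖x‖⁻¹ • x) ω' ω]

/-! ### Weighted implication -/

/-- A version of implication for the function `x ↦ w(x / ρ) p(x)` at each small scale `ρ`. -/
def ImpliesWeighted (m : ℕ) (I : AddSubgroup (MvPolynomial (Fin n) ℝ))
    (p : MvPolynomial (Fin n) ℝ) (w : Space n → ℝ) : Prop :=
  ∃ (A : ℝ) (ι : Type) (_ : Fintype ι) (Q : ι → MvPolynomial (Fin n) ℝ), (∀ l, Q l ∈ I) ∧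
    ∀ ε > 0, ∃ δ > 0, ∃ r > 0, ∀ ρ : ℝ, 0 < ρ → ρ ≤ r →
      ∃ (F : Space n → ℝ) (S : ι → Space n → ℝ),
        (∀ x, JetBound m F x (ε * ρ ^ m) ρ) ∧ (∀ l x, JetBound m (S l) x A ρ) ∧
        ∀ x, x ≠ 0 → ‖x‖⁻¹ • x ∈ Metric.thickening δ (Allow m I) →
          w (ρ⁻¹ • x) * evalAt p x = F x + ∑ l, S l x * evalAt (Q l) x

namespace ImpliesWeighted

variable {I : AddSubgroup (MvPolynomial (Fin n) ℝ)} {p : MvPolynomial (Fin n) ℝ}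

theorem zero : ImpliesWeighted m I p fun _ => 0 := by
  refine ⟨0, Empty, inferInstance, Empty.elim, fun l => l.elim, fun ε hε =>
    ⟨1, one_pos, 1, one_pos, fun ρ hρ _ => ⟨fun _ => 0, fun l => l.elim, fun x =>
      JetBound.zero (by positivity) hρ, fun l => l.elim, fun x _ _ => by simp⟩⟩⟩

theorem add {w₁ w₂ : Space n → ℝ} (h₁ : ImpliesWeighted m I p w₁)
    (h₂ : ImpliesWeighted m I p w₂) : ImpliesWeighted m I p fun u => w₁ u + w₂ u := by
  obtain ⟨A₁, ι₁, _, Q₁, hQ₁, h₁⟩ := h₁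
  obtain ⟨A₂, ι₂, _, Q₂, hQ₂, h₂⟩ := h₂
  refine ⟨max A₁ A₂, ι₁ ⊕ ι₂, inferInstance, Sum.elim Q₁ Q₂, ?_, fun ε hε => ?_⟩
  · rintro (l | l)
    exacts [hQ₁ l, hQ₂ l]
  obtain ⟨δ₁, hδ₁, r₁, hr₁, h₁⟩ := h₁ (ε / 2) (by positivity)
  obtain ⟨δ₂, hδ₂, r₂, hr₂, h₂⟩ := h₂ (ε / 2) (by positivity)
  refine ⟨min δ₁ δ₂, lt_min hδ₁ hδ₂, min r₁ r₂, lt_min hr₁ hr₂, fun ρ hρ hρr => ?_⟩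
  obtain ⟨F₁, S₁, hF₁, hS₁, e₁⟩ := h₁ ρ hρ (hρr.trans (min_le_left _ _))
  obtain ⟨F₂, S₂, hF₂, hS₂, e₂⟩ := h₂ ρ hρ (hρr.trans (min_le_right _ _))
  refine ⟨fun x => F₁ x + F₂ x, Sum.elim S₁ S₂, fun x => ?_, ?_, fun x hx hxd => ?_⟩
  · exact ((hF₁ x).add (hF₂ x)).mono hρ (by apply le_of_eq; ring)
  · rintro (l | l) x
    exacts [(hS₁ l x).mono hρ (le_max_left _ _), (hS₂ l x).mono hρ (le_max_right _ _)]
  · have h1 := e₁ x hx (Metric.thickening_mono (min_le_left _ _) _ hxd)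
    have h2 := e₂ x hx (Metric.thickening_mono (min_le_right _ _) _ hxd)
    simp only [Fintype.sum_sum_type, Sum.elim_inl, Sum.elim_inr]
    rw [add_mul, h1, h2]
    ring

theorem sum {ι : Type*} {T : Finset ι} {w : ι → Space n → ℝ}
    (h : ∀ i ∈ T, ImpliesWeighted m I p (w i)) :
    ImpliesWeighted m I p fun u => ∑ i ∈ T, w i u := by
  classical
  induction T using Finset.induction_on with
  | empty => simpa using zero
  | insert i T hi ih =>
    simp only [Finset.sum_insert hi]
    exact (h i (by simp)).add (ih fun j hj => h j (by simp [hj]))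

/-- A weight which is `1` on the relevant part of an annulus yields implication. -/
theorem implies {w : Space n → ℝ} (h : ImpliesWeighted m I p w) {δ₀ : ℝ} (hδ₀ : 0 < δ₀)
    (hw : ∀ u : Space n, 1 / 2 < ‖u‖ → ‖u‖ < 2 → ‖u‖⁻¹ • u ∈ Metric.thickening δ₀ (Allow m I) →
      w u = 1) : Implies m I p := by
  obtain ⟨A, ι, _, Q, hQ, h⟩ := h
  let e := Fintype.equivFin ι
  refine ⟨max A 1, by positivity, Fintype.card ι, fun l => Q (e.symm l), fun l => hQ _,
    fun ε hε => ?_⟩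
  obtain ⟨δ, hδ, r, hr, h⟩ := h ε hε
  refine ⟨min δ δ₀, lt_min hδ hδ₀, r, hr, fun ρ hρ hρr => ?_⟩
  obtain ⟨F, S, hF, hS, hE⟩ := h ρ hρ hρr
  refine ⟨F, fun l => S (e.symm l), fun x _ => (hF x).1.contDiffWithinAt,
    fun l x _ => (hS _ x).1.contDiffWithinAt, fun x _ α hα => ?_, fun x _ α hα l => ?_,
    fun x hx hxd => ?_⟩
  · refine ((hF x).abs_multiDeriv_le hα).trans (le_of_eq ?_)
    rw [mul_assoc, inv_pow, ← pow_sub₀ ρ hρ.ne' hα]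
  · refine (((hS _ x).mono hρ (le_max_left A 1)).abs_multiDeriv_le hα).trans (le_of_eq ?_)
    rw [zpow_neg, zpow_natCast, inv_pow]
  · have hxpos : 0 < ‖x‖ := lt_trans (by positivity) hx.1
    have hx0 : x ≠ 0 := norm_pos_iff.1 hxpos
    have hnorm : ‖ρ⁻¹ • x‖ = ρ⁻¹ * ‖x‖ := by
      rw [norm_smul, Real.norm_eq_abs, abs_of_pos (inv_pos.2 hρ)]
    have h1 : w (ρ⁻¹ • x) = 1 := by
      refine hw _ ?_ ?_ ?_
      · have := hx.1
        rw [hnorm, lt_inv_mul_iff₀ hρ]; linarith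
      · have := hx.2
        rw [hnorm, inv_mul_lt_iff₀ hρ]; linarith
      · have : ‖ρ⁻¹ • x‖⁻¹ • ρ⁻¹ • x = ‖x‖⁻¹ • x := by
          rw [hnorm, smul_smul]
          congr 1
          field_simp
        rw [this]
        exact Metric.thickening_mono (min_le_right _ _) _ hxd
    have h2 := hE x hx0 (Metric.thickening_mono (min_le_left _ _) _ hxd)
    rw [h1, one_mul] at h2
    rw [h2]
    congr 1
    exact (e.symm.sum_comp fun l => S l x * evalAt (Q l) x).symm

end ImpliesWeighted

/-! ### Globalizing negligible functions and localizing strong implication -/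

theorem IsNegligible.exists_whitneyBound {Ω U : Set (Space n)} {F : Space n → ℝ}
    (h : IsNegligible m U Ω F) (hU : IsOpen U) (hF : ContDiffOn ℝ m F U) {ε : ℝ} (hε : 0 < ε) :
    ∃ δ > 0, ∃ r > 0, WhitneyBound m ε (cone Ω δ r) F := by
  obtain ⟨δ, hδ, r, hr, hsub, h1, h2⟩ := h ε hε
  exact ⟨δ, hδ, r, hr, fun x hx => hF.contDiffAt (hU.mem_nhds (hsub hx)), h1, h2⟩

/-- A negligible function agrees, near the set of directions and at each small scale, with a
globally defined function with small derivatives. -/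
theorem IsNegligible.exists_global {Ω U : Set (Space n)} {F : Space n → ℝ}
    (h : IsNegligible m U Ω F) (hΩ : Ω ⊆ Directions n) (hU : IsOpen U)
    (hF : ContDiffOn ℝ m F U) {ε : ℝ} (hε : 0 < ε) :
    ∃ δ > 0, ∃ r > 0, ∀ ρ : ℝ, 0 < ρ → ρ ≤ r → ∃ G : Space n → ℝ,
      (∀ x, JetBound m G x (ε * ρ ^ m) ρ) ∧
      ∀ x, ρ / 4 ≤ ‖x‖ → ‖x‖ ≤ 4 * ρ → ‖x‖⁻¹ • x ∈ Metric.thickening δ Ω → G x = F x := by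
  rcases Ω.eq_empty_or_nonempty with rfl | ⟨ω₀, hω₀⟩
  · exact ⟨1, one_pos, 1, one_pos, fun ρ hρ _ => ⟨fun _ => 0,
      fun x => JetBound.zero (by positivity) hρ, fun x _ _ hx => by simp at hx⟩⟩
  obtain ⟨C, hC, hext⟩ := exists_extension_of_whitneyBound n m
  obtain ⟨δ, hδ, r, hr, hW⟩ := h.exists_whitneyBound hU hF (show 0 < ε / C by positivity)
  -- `N` depends on `ε` through `δ`, which is harmless because `C` was fixed before. It makes `s = ρ
  -- 2^{-N} / 2` at most `ρ / 64` and `ρ δ / 64`, so the `4 s`-neighbourhood of `E` stays in the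
  -- cone of aperture `δ`.
  obtain ⟨N, hN⟩ := exists_pow_lt_of_lt_one (show 0 < min 1 δ / 32 by positivity)
    (show (1 / 2 : ℝ) < 1 by norm_num)
  have hN1 : (1 / 2 : ℝ) ^ N < 1 / 32 := hN.trans_le (by linarith [min_le_left 1 δ])
  have hN2 : (1 / 2 : ℝ) ^ N < δ / 32 := hN.trans_le (by linarith [min_le_right 1 δ])
  have hpow : (0 : ℝ) < (1 / 2) ^ N := by positivity
  -- For `‖x‖ ≤ 4 ρ` this aperture keeps `x` within `4 ρ · 2^{-N} / 16 = s / 2` of `E`, where the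
  -- extension equals `F`.
  refine ⟨(1 / 2) ^ N / 16, by positivity, r / 8, by positivity, fun ρ hρ hρr => ?_⟩
  set s : ℝ := ρ * (1 / 2) ^ N / 2 with hs
  have hs0 : 0 < s := by positivity
  have hsρ : s * 2 ^ (N + 1) = ρ := by
    have : (1 / 2 : ℝ) ^ N * 2 ^ N = 1 := by rw [← mul_pow]; norm_num
    calc s * 2 ^ (N + 1) = ρ * ((1 / 2 : ℝ) ^ N * 2 ^ N) := by rw [hs, pow_succ]; ring
      _ = ρ := by rw [this, mul_one]
  have hs1 : s ≤ ρ / 64 := by rw [hs]; nlinarith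
  have hs2 : s ≤ ρ * δ / 64 := by rw [hs]; nlinarith
  let E : Set (Space n) := {y | ∃ t : ℝ, ρ / 4 ≤ t ∧ t ≤ 4 * ρ ∧ ∃ ω ∈ Ω, y = t • ω}
  have hnorm : ∀ ω ∈ Ω, ‖ω‖ = 1 := fun ω hω => by simpa [Directions] using hΩ hω
  have hEnorm : ∀ t : ℝ, ρ / 4 ≤ t → ∀ ω ∈ Ω, ‖t • ω‖ = t := fun t ht ω hω => by
    rw [norm_smul, hnorm ω hω, mul_one, Real.norm_eq_abs, abs_of_nonneg (by linarith)]
  obtain ⟨G, hG, hGF⟩ := hext E (cone Ω δ r) F (ε / C) s N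
    ⟨ρ • ω₀, ρ, by linarith, by linarith, ω₀, hω₀, rfl⟩ (by positivity) hs0
    (by
      rintro _ ⟨t, ht, ht', ω, hω, rfl⟩
      rw [hsρ, hEnorm t ht ω hω]
      exact ht')
    (by
      rintro _ ⟨t, ht, ht', ω, hω, rfl⟩ x hx
      have h1 := hEnorm t ht ω hω
      have h2 := abs_le.1 (abs_norm_sub_norm_le x (t • ω))
      rw [h1] at h2
      have hxpos : 0 < ‖x‖ := by linarith
      refine ⟨hxpos, by linarith, Metric.mem_thickening_iff.2 ⟨ω, hω, ?_⟩⟩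
      have ht0 : 0 < t := by linarith
      rw [dist_eq_norm]
      refine (norm_normalize_sub_le (hnorm ω hω) ht0 (norm_pos_iff.1 hxpos)).trans_lt ?_
      rw [div_lt_iff₀ ht0]
      nlinarith)
    hW
  rw [hsρ, mul_div_cancel₀ _ hC.ne'] at hG
  refine ⟨G, hG, fun x hx1 hx2 hx => hGF x ?_⟩
  obtain ⟨ω, hω, hxω⟩ := Metric.mem_thickening_iff.1 hx
  have hmem : ‖x‖ • ω ∈ E := ⟨‖x‖, hx1, hx2, ω, hω, rfl⟩
  refine (Metric.infDist_le_dist_of_mem hmem).trans_lt ?_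
  rw [dist_eq_norm] at hxω ⊢
  rw [norm_sub_norm_smul]
  calc ‖x‖ * ‖‖x‖⁻¹ • x - ω‖ ≤ (4 * ρ) * ‖‖x‖⁻¹ • x - ω‖ := by gcongr
    _ < (4 * ρ) * ((1 / 2) ^ N / 16) := by gcongr
    _ = s / 2 := by rw [hs]; ring

/-- Strong directional implication localizes to weights supported in the cone. -/
theorem impliesWeighted_of_bump {I : AddSubgroup (MvPolynomial (Fin n) ℝ)}
    {p : MvPolynomial (Fin n) ℝ} {ω : Space n} {δ r : ℝ} (hr : 0 < r) {L : ℕ}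
    {Q : Fin L → MvPolynomial (Fin n) ℝ} {S : Fin L → Space n → ℝ} {C : Fin L → ℝ}
    {F : Space n → ℝ} (hQ : ∀ l, Q l ∈ I)
    (hS : ∀ l, ContDiffOn ℝ m (S l) (cone {ω} δ r)) (hC : ∀ l, 0 < C l)
    (hF : ContDiffOn ℝ m F (cone {ω} δ r))
    (hneg : IsNegligible m (cone {ω} δ r) (Allow m I ∩ dome {ω} δ) F)
    (hSb : ∀ α : MultiIndex n, order α ≤ m → ∀ l, ∀ x ∈ cone {ω} δ r,
      |multiDeriv α (S l) x| ≤ C l * ‖x‖ ^ (-(order α : ℤ)))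
    (hp : ∀ x ∈ cone {ω} δ r, evalAt p x = ∑ l, S l x * evalAt (Q l) x + F x)
    {z : Space n} {σ B : ℝ} (hσ : 0 < σ) (hσ1 : σ ≤ 1) {φ : Space n → ℝ}
    (hφ : ContDiff ℝ m φ) (hφb : ∀ u, JetBound m φ u B σ) (hφs : ∀ u, φ u ≠ 0 → ‖u - z‖ < σ)
    (hball : ∀ u : Space n, ‖u - z‖ < 2 * σ →
      1 / 4 ≤ ‖u‖ ∧ ‖u‖ ≤ 4 ∧ ‖u‖⁻¹ • u ∈ Metric.thickening δ {ω}) :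
    ImpliesWeighted m I p φ := by
  have hB : 0 ≤ B := (hφb 0).nonneg
  -- The dilated bump lives at scale `σ ρ`; reading it at scale `ρ` costs `σ⁻¹ ^ m`, independent of
  -- `ρ` and `ε`.
  set B' : ℝ := σ⁻¹ ^ m * B with hB'def
  have hB' : 0 ≤ B' := by positivity
  have hφρ : ∀ ρ : ℝ, 0 < ρ → ∀ x, JetBound m (fun y => φ (ρ⁻¹ • y)) x B' ρ := fun ρ hρ x =>
    ((hφb (ρ⁻¹ • x)).comp_smul hφ hρ).rescale (by positivity) hρ ((one_le_inv₀ hσ).2 hσ1)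
      (by rw [inv_mul_cancel_left₀ hσ.ne'])
  have hopen : IsOpen (cone {ω} δ r) := isOpen_cone _ _ _
  have hsumC : ∀ l, C l ≤ ∑ l, C l := fun l =>
    Finset.single_le_sum (fun j _ => (hC j).le) (Finset.mem_univ l)
  have hsumC0 : 0 ≤ ∑ l, C l := Finset.sum_nonneg fun j _ => (hC j).le
  have hnorm : ∀ ρ : ℝ, 0 < ρ → ∀ x : Space n, ‖ρ⁻¹ • x‖ = ρ⁻¹ * ‖x‖ := fun ρ hρ x => by
    rw [norm_smul, Real.norm_eq_abs, abs_of_pos (inv_pos.2 hρ)]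
  have hdir : ∀ ρ : ℝ, 0 < ρ → ∀ x : Space n, ‖ρ⁻¹ • x‖⁻¹ • ρ⁻¹ • x = ‖x‖⁻¹ • x := by
    intro ρ hρ x
    rw [hnorm ρ hρ, smul_smul]
    congr 1
    field_simp
  have hcone : ∀ ρ : ℝ, 0 < ρ → ρ ≤ r / 8 → ∀ x : Space n, ‖ρ⁻¹ • x - z‖ < 2 * σ →
      ρ / 4 ≤ ‖x‖ ∧ ‖x‖ ≤ 4 * ρ ∧ x ∈ cone {ω} δ r := by
    intro ρ hρ hρr x hx
    obtain ⟨h1, h2, h3⟩ := hball _ hx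
    rw [hdir ρ hρ] at h3
    rw [hnorm ρ hρ, le_inv_mul_iff₀ hρ] at h1
    rw [hnorm ρ hρ, inv_mul_le_iff₀ hρ] at h2
    exact ⟨by linarith, by linarith, by linarith, by linarith, h3⟩
  refine ⟨2 ^ m * B' * (4 ^ m * ((n + 1) ^ m * ∑ l, C l)), Fin L, inferInstance, Q, hQ,
    fun ε hε => ?_⟩
  obtain ⟨δ', hδ', r', hr', hglob⟩ := hneg.exists_global (fun x hx => hx.2.1) hopen hF
    (show 0 < ε / (2 ^ m * B' + 1) by positivity)
  refine ⟨min δ' (σ / 4), by positivity, min (r / 8) r', by positivity, fun ρ hρ hρr => ?_⟩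
  obtain ⟨G, hG, hGF⟩ := hglob ρ hρ (hρr.trans (min_le_right _ _))
  have hcone' := hcone ρ hρ (hρr.trans (min_le_left _ _))
  refine ⟨fun x => φ (ρ⁻¹ • x) * G x, fun l x => φ (ρ⁻¹ • x) * S l x, fun x => ?_,
    fun l x => ?_, fun x hx hxd => ?_⟩
  · refine ((hφρ ρ hρ x).mul (hG x) hρ).mono hρ ?_
    have h1 : 2 ^ m * B' * (ε / (2 ^ m * B' + 1)) ≤ ε := by
      rw [mul_div_assoc', div_le_iff₀ (by positivity)]
      nlinarith
    calc 2 ^ m * B' * (ε / (2 ^ m * B' + 1) * ρ ^ m)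
        = 2 ^ m * B' * (ε / (2 ^ m * B' + 1)) * ρ ^ m := by ring
      _ ≤ ε * ρ ^ m := by gcongr
  · by_cases hxz : ‖ρ⁻¹ • x - z‖ < 2 * σ
    · obtain ⟨h1, h2, h3⟩ := hcone' x hxz
      have hx0 : 0 < ‖x‖ := h3.1
      have hSl : JetBound m (S l) x ((n + 1) ^ m * C l) ‖x‖ := by
        refine JetBound.of_multiDeriv ((hS l).contDiffAt (hopen.mem_nhds h3)) (hC l).le hx0
          fun α hα => (hSb α hα l x h3).trans (le_of_eq ?_)
        rw [zpow_neg, zpow_natCast, inv_pow]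
      refine ((hφρ ρ hρ x).mul (hSl.rescale (c := 4) hx0 hρ (by norm_num) (by linarith))
        hρ).mono hρ ?_
      have := hsumC l
      gcongr
    -- Here `S l` may be uncontrolled, but the bump vanishes near `x`.
    · refine (JetBound.zero (by positivity) hρ).congr ?_
      have hc : Continuous fun y : Space n => ‖ρ⁻¹ • y - z‖ := by fun_prop
      filter_upwards [hc.continuousAt.eventually
        (lt_mem_nhds (show σ < ‖ρ⁻¹ • x - z‖ by linarith))] with y hy
      by_contra hne
      exact absurd (hφs _ (left_ne_zero_of_mul hne)) (not_lt.2 hy.le)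
  · by_cases h0 : φ (ρ⁻¹ • x) = 0
    · simp [h0]
    have hxz := hφs _ h0
    obtain ⟨h1, h2, h3⟩ := hcone' x (by linarith)
    have hGx : G x = F x := by
      refine hGF x h1 h2 ?_
      obtain ⟨ω', hω', hxω'⟩ := Metric.mem_thickening_iff.1 hxd
      refine Metric.mem_thickening_iff.2 ⟨ω', ⟨hω', hω'.1, ?_⟩,
        hxω'.trans_le (min_le_left _ _)⟩
      have hω'1 : ‖ω'‖ = 1 := by simpa [Directions] using hω'.1
      set u := ρ⁻¹ • x with hu
      obtain ⟨hu1, hu2, -⟩ := hball u (by linarith)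
      -- Negligibility concerns only allowed directions in the dome about `ω`, so `ω'` must be shown
      -- to lie there. As `‖u‖ ≤ 4` and the aperture is at most `σ / 4`, the point `‖u‖ • ω'` is
      -- within `σ` of `u`, hence within `2 σ` of `z`, where `hball` applies.
      have hk : ‖u - ‖u‖ • ω'‖ < σ := by
        rw [norm_sub_norm_smul, hdir ρ hρ, ← dist_eq_norm]
        have := hxω'.trans_le (min_le_right _ _)
        nlinarith [dist_nonneg (x := ‖x‖⁻¹ • x) (y := ω')]
      have hk2 : ‖‖u‖ • ω' - z‖ < 2 * σ := by
        have := norm_sub_le_norm_sub_add_norm_sub (‖u‖ • ω') u z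
        rw [norm_sub_rev (‖u‖ • ω') u] at this
        linarith
      have h5 := (hball _ hk2).2.2
      rwa [norm_smul, hω'1, mul_one, norm_norm, smul_smul,
        inv_mul_cancel₀ (by linarith), one_smul] at h5
    beta_reduce
    rw [hp x h3, hGx, mul_add, Finset.mul_sum, add_comm]
    congr 1
    refine Finset.sum_congr rfl fun l _ => ?_
    ring

end ImpliedJets

/-! ### Patching the directional decompositions by compactness -/

theorem corollary3p13 (m n : ℕ) (hm : 1 ≤ m) (hn : 1 ≤ n)
    (I : AddSubgroup (MvPolynomial (Fin n) ℝ)) (hI : ImpliedJets.IsJetIdeal m I)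
    (p : MvPolynomial (Fin n) ℝ) (hp : p ∈ ImpliedJets.JetSpaceZero n m)
    (h : ∀ ω ∈ ImpliedJets.Allow m I, ImpliedJets.StronglyImpliesInDirection m I p ω) :
    ImpliedJets.Implies m I p := by
  classical
  open ImpliedJets in
  choose! δ hδ r hr L Q S C F hQ hS hC hF hneg hSb hp' using h
  have hnorm : ∀ ω ∈ Allow m I, ‖ω‖ = 1 := fun ω hω => by simpa [Directions] using hω.1
  have hcpt : IsCompact (Allow m I) :=
    (isCompact_sphere (0 : Space n) 1).of_isClosed_subset (isClosed_allow m I) fun ω hω => hω.1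
  set K : Set (Space n) := (fun q : ℝ × Space n => q.1 • q.2) ''
    (Set.Icc (1 / 2) 2 ×ˢ Allow m I) with hK
  have hKc : IsCompact K := (isCompact_Icc.prod hcpt).image (by fun_prop)
  let c : Allow m I → Set (Space n) := fun ω =>
    {x | x ≠ 0 ∧ ‖x‖⁻¹ • x ∈ Metric.thickening (δ ω) {(ω : Space n)}}
  have hKcover : K ⊆ ⋃ ω, c ω := by
    rintro _ ⟨⟨t, ω⟩, ⟨ht, hω⟩, rfl⟩
    have ht0 : 0 < t := lt_of_lt_of_le (by norm_num) ht.1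
    have hω1 := hnorm ω hω
    have hω0 : ω ≠ 0 := by rintro rfl; simp at hω1
    refine Set.mem_iUnion.2 ⟨⟨ω, hω⟩, smul_ne_zero ht0.ne' hω0, ?_⟩
    simp only
    rw [norm_smul, hω1, mul_one, Real.norm_eq_abs, abs_of_pos ht0, smul_smul,
      inv_mul_cancel₀ ht0.ne', one_smul, Metric.thickening_singleton]
    exact Metric.mem_ball_self (hδ ω hω)
  obtain ⟨l, hl, hleb⟩ := lebesgue_number_lemma_of_metric hKc
    (fun ω => isOpen_directed_cone _ Metric.isOpen_thickening) hKcover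
  -- A bump is kept when its centre is within `2 σ` of `K`, and its `2 σ`-ball must fit in one cone:
  -- total distance `4 σ ≤ l`. The bound `1/16` keeps norms in that ball between `1/4` and `4`.
  set σ : ℝ := min (l / 4) (1 / 16) with hσdef
  have hσ : 0 < σ := by positivity
  have hσl : 4 * σ ≤ l := by linarith [min_le_left (l / 4) (1 / 16 : ℝ)]
  have hσ1 : σ ≤ 1 / 16 := min_le_right _ _
  obtain ⟨B, hB, M, hpart⟩ := exists_isPartition n m
  obtain ⟨T, z, φ, hφ⟩ := hpart σ hσ 4
  have hKnorm : ∀ k ∈ K, 1 / 2 ≤ ‖k‖ ∧ ‖k‖ ≤ 2 := by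
    rintro _ ⟨⟨t, ω⟩, ⟨ht, hω⟩, rfl⟩
    simp only
    rw [norm_smul, hnorm ω hω, mul_one, Real.norm_eq_abs,
      abs_of_pos (lt_of_lt_of_le (by norm_num) ht.1)]
    exact ht
  have hw : ImpliesWeighted m I p
      fun u => ∑ i ∈ T.filter (fun i => ∃ k ∈ K, ‖z i - k‖ < 2 * σ), φ i u := by
    refine ImpliesWeighted.sum fun i hi => ?_
    obtain ⟨k, hk, hzk⟩ := (Finset.mem_filter.1 hi).2
    obtain ⟨⟨ω, hω⟩, hkω⟩ := hleb k hk
    refine impliesWeighted_of_bump (hr ω hω) (hQ ω hω) (hS ω hω) (hC ω hω) (hF ω hω)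
      (hneg ω hω) (hSb ω hω) (hp' ω hω) hσ (by linarith) (hφ.contDiff i) (hφ.jetBound i)
      (hφ.norm_lt i) fun u hu => ?_
    have huk : ‖u - k‖ < 4 * σ := by
      linarith [norm_sub_le_norm_sub_add_norm_sub u (z i) k]
    have h1 := abs_le.1 (abs_norm_sub_norm_le u k)
    have h2 := hKnorm k hk
    exact ⟨by linarith, by linarith, (hkω (by rw [Metric.mem_ball, dist_eq_norm]; linarith)).2⟩
  -- Since `‖u‖ < 2`, this aperture puts `u` within `σ` of `K`; a bump nonzero at `u` then has its
  -- centre within `2 σ` of `K`, so no discarded bump contributes at `u`.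
  refine hw.implies (δ₀ := σ / 4) (by positivity) fun u hu1 hu2 hu => ?_
  rw [← hφ.sum_eq_one u (by linarith)]
  refine Finset.sum_subset (Finset.filter_subset _ _) fun i hi hni => ?_
  by_contra h0
  refine hni (Finset.mem_filter.2 ⟨hi, ?_⟩)
  obtain ⟨ω, hω, huω⟩ := Metric.mem_thickening_iff.1 hu
  refine ⟨‖u‖ • ω, ⟨(‖u‖, ω), ⟨⟨hu1.le, hu2.le⟩, hω⟩, rfl⟩, ?_⟩
  have h1 := hφ.norm_lt i u h0
  have h2 : ‖u - ‖u‖ • ω‖ < σ := by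
    rw [norm_sub_norm_smul, ← dist_eq_norm]
    nlinarith [dist_nonneg (x := ‖u‖⁻¹ • u) (y := ω)]
  have h3 := norm_sub_le_norm_sub_add_norm_sub (z i) u (‖u‖ • ω)
  rw [norm_sub_rev (z i) u] at h3
  linarith
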